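/- Let $g$ be a rational function on the Riemann sphere $\overline{\mathbb C}$ of degree at least two. A critical value of $g$ is a point $g(x)$ where $x\in\overline{\mathbb C}$ is a critical point of $g$ (that is, the derivative of $g$ at $x$, read in local coordinates, vanishes). For a critical value $c$ of $g$ define its postcritical set $$P(c)=\overline{\{g^n(c): n\ge 0\}}.$$ Let $c_0$ be a critical value of $g$ which is not in the basin of an attracting (possibly superattracting) cycle of $g$, and assume that $P(c_0)$ is disjoint from the union $X=\bigcup_{c\neq c_0}P(c)$ of the postcritical sets of all other critical values $c$ of $g$. Then $$\chi_-(g,c_0)=\liminf_{n\to\infty}\frac1n\log\|Dg^n(c_0)\|\ \ge\ 0,$$ where $\|\cdot\|$ denotes the norm of the derivative with respect to the spherical metric $2|dz|/(1+|z|^2)$ (and $\log 0=-\infty$). -/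

import Mathlib

open Filter Topology

noncomputable section

/-- The Riemann sphere, with its topology of one-point compactification of `ℂ`. -/
abbrev RiemannSphere : Type := OnePoint ℂ

namespace RiemannSphere

/-- The local holomorphic coordinate used around the point `b`: it is `z` if `b ≠ ∞` and
`1 / z` if `b = ∞`.  (Its value at the one point outside the domain of the chart is irrelevant.) -/
def coord : RiemannSphere → RiemannSphere → ℂ
  | some _, some z => z
  | some _, none => 0
  | none, some z => z⁻¹
  | none, none => 0

open Classical in
/-- The inverse of the local coordinate around `b`. -/
def param : RiemannSphere → ℂ → RiemannSphere
  | some _, u => (u : OnePoint ℂ)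
  | none, u => if u = 0 then OnePoint.infty else ((u⁻¹ : ℂ) : OnePoint ℂ)

/-- The complex derivative of `f` at `b`, read in the local coordinates around `b` and `f b`. -/
def chartDeriv (f : RiemannSphere → RiemannSphere) (b : RiemannSphere) : ℂ :=
  deriv (fun u : ℂ => coord (f b) (f (param b u))) (coord b b)

/-- The density `2 / (1 + |u|²)` of the spherical metric at `b`; the expression is the same in
the coordinate `u = z` and in the coordinate `u = 1 / z`. -/
def density (b : RiemannSphere) : ℝ := 2 / (1 + ‖coord b b‖ ^ 2)

/-- The norm of the derivative of `f` at `b` with respect to the spherical metric. -/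
def sphericalDeriv (f : RiemannSphere → RiemannSphere) (b : RiemannSphere) : ℝ :=
  density (f b) * ‖chartDeriv f b‖ / density b

/-- The critical values of `g`: images of the points at which the derivative vanishes. -/
def criticalValues (g : RiemannSphere → RiemannSphere) : Set RiemannSphere :=
  g '' {x | chartDeriv g x = 0}

/-- The forward orbit of `c`. -/
def orbit (g : RiemannSphere → RiemannSphere) (c : RiemannSphere) : Set RiemannSphere :=
  Set.range fun n : ℕ => g^[n] c

/-- The postcritical set of `c`: the closure of the forward orbit `c, g c, g (g c), …`. -/
def postcriticalSet (g : RiemannSphere → RiemannSphere) (c : RiemannSphere) :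
    Set RiemannSphere :=
  closure (orbit g c)

/-- The orbit of `p` is an attracting (possibly superattracting) cycle: `p` has some period
`m ≥ 1`, here the minimal one, and its multiplier has modulus `< 1`. The two points at which
the coordinates are taken agree, so `chartDeriv` is the multiplier. -/
def IsAttractingPeriodicPt (g : RiemannSphere → RiemannSphere) (p : RiemannSphere) : Prop :=
  p ∈ Function.periodicPts g ∧ ‖chartDeriv (g^[Function.minimalPeriod g p]) p‖ < 1

/-- `z` lies in the basin of some attracting cycle: the orbit of `z` converges to the cycle. -/
def InAttractingBasin (g : RiemannSphere → RiemannSphere) (z : RiemannSphere) : Prop :=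
  ∃ p, IsAttractingPeriodicPt g p ∧ Tendsto (fun n : ℕ => g^[n] z) atTop (𝓝ˢ (orbit g p))

/-- The lower Lyapunov exponent of `g` at `z` in the spherical metric,
`liminf (1 / n) log ‖D(gⁿ)(z)‖`, as an extended real number (with `log 0 = -∞`). -/
def lowerLyapunov (g : RiemannSphere → RiemannSphere) (z : RiemannSphere) : EReal :=
  liminf (fun n : ℕ => ENNReal.log (ENNReal.ofReal (sphericalDeriv (g^[n]) z)) / (n : EReal)) atTop

end RiemannSphere

namespace RatFunc

/-- The degree of a rational function `p / q` in lowest terms, `max (deg p) (deg q)`. -/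
def mapDegree (R : RatFunc ℂ) : ℕ := max R.num.natDegree R.denom.natDegree

open Classical in
/-- The self-map of the Riemann sphere given by the rational function `R = p / q` in lowest terms:
poles are sent to `∞`, and the value at `∞` is the limit of `p z / q z` as `z → ∞`, which is the
quotient of the coefficients of degree `max (deg p) (deg q)`. -/
def sphereMap (R : RatFunc ℂ) : RiemannSphere → RiemannSphere
  | some z =>
      if R.denom.eval z = 0 then OnePoint.infty
      else ((R.num.eval z / R.denom.eval z : ℂ) : OnePoint ℂ)
  | none =>
      if R.denom.coeff R.mapDegree = 0 then OnePoint.infty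
      else ((R.num.coeff R.mapDegree / R.denom.coeff R.mapDegree : ℂ) : OnePoint ℂ)

end RatFunc

end

/-! Since the degree is at least two, there is a critical value q ≠ c₀
(`RatFunc.exists_criticalValue_ne`): otherwise the map would be a covering over the simply connected
complement of c₀, and Liouville's theorem would make it injective over that complement. A Möbius
conjugation moves q to ∞. Then ∞ ∈ X, so the orbit x n of x 0 = c₀ is bounded in ℂ and stays at a
definite distance from the closed set X. An inverse branch of an iterate on a small disc about x n
extends one step further unless its image contains x 0, because any other critical value in the
image would carry a point of the disc into X. Only this property is kept (`PlanarOrbit`). The core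
is `PlanarOrbit.dichotomy`: such an orbit is captured by an attracting cycle, or |DFⁿ(x 0)| ≥
exp(-χn) eventually for every χ > 0. On the bounded orbit, planar and spherical derivatives are
comparable, so the second case gives the theorem.

For the core, pull a disc of radius ρ about x t back with slowly shrinking radii until it swallows x
0, say after k steps. Koebe distortion costs a factor polynomial in k, hence subexponential. If no
iterate maps a disc centred on the orbit well inside itself, then l = |DF^k(x (t-k))| satisfies, up
to this factor, l ≥ ρ / |x t - x 0| and l ≤ ρ / |x (t-k) - x 0| (`PlanarOrbit.exists_step`).
Iterating from t = n down to 0 factors DFⁿ(x 0) into such l.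

Take ρ = |x t - x 0| when this is at most δ₀ (near), and ρ = δ₀ exp(-D) otherwise (far). Near steps
are long, so they lose at most εk in log l; far steps lose at most D plus constants. Exponential
decay thus forces a number of far steps proportional to n. By the upper bound on l, with |x t - x 0|
capped at δ₀ as a telescoping potential, every far step also contracts by exp(-D), up to the cost.
So there are many far times on successively deeper levels of contraction; two of their points are
close by pigeonhole, and the iterate joining them maps a disc well inside itself, a contradiction.
Such a self-map of a disc produces an attracting cycle that captures the orbit. -/

noncomputable section

open Metric Set Filter Topology

/-! ### Koebe-type distortion estimates for univalent maps -/

/-- `φ` is holomorphic on the disc of centre `x` and radius `R`, and `ψ` is a holomorphic left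
inverse of it; in particular `φ` is univalent. -/
structure HoloInverse (φ ψ : ℂ → ℂ) (x : ℂ) (R : ℝ) : Prop where
  pos : 0 < R
  holo : DifferentiableOn ℂ φ (ball x R)
  inv : ∀ z ∈ ball x R, ψ (φ z) = z
  inv_holo : ∀ z ∈ ball x R, DifferentiableAt ℂ ψ (φ z)

namespace HoloInverse

variable {φ ψ : ℂ → ℂ} {x : ℂ} {R : ℝ}

lemma differentiableAt (h : HoloInverse φ ψ x R) {z : ℂ} (hz : z ∈ ball x R) :
    DifferentiableAt ℂ φ z :=
  h.holo.differentiableAt (isOpen_ball.mem_nhds hz)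

lemma deriv_mul_deriv (h : HoloInverse φ ψ x R) {z : ℂ} (hz : z ∈ ball x R) :
    deriv ψ (φ z) * deriv φ z = 1 := by
  have h1 : HasDerivAt (ψ ∘ φ) (deriv ψ (φ z) * deriv φ z) z :=
    (h.inv_holo z hz).hasDerivAt.comp z (h.differentiableAt hz).hasDerivAt
  have h2 : ψ ∘ φ =ᶠ[𝓝 z] id := by
    filter_upwards [isOpen_ball.mem_nhds hz] with w hw using h.inv w hw
  exact (h1.congr_of_eventuallyEq h2.symm).unique (hasDerivAt_id z)

lemma deriv_ne_zero (h : HoloInverse φ ψ x R) {z : ℂ} (hz : z ∈ ball x R) : deriv φ z ≠ 0 :=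
  fun h0 => by simpa [h0] using h.deriv_mul_deriv hz

lemma norm_deriv_pos (h : HoloInverse φ ψ x R) {z : ℂ} (hz : z ∈ ball x R) : 0 < ‖deriv φ z‖ :=
  norm_pos_iff.2 (h.deriv_ne_zero hz)

lemma norm_deriv_inv (h : HoloInverse φ ψ x R) {z : ℂ} (hz : z ∈ ball x R) :
    ‖deriv ψ (φ z)‖ * ‖deriv φ z‖ = 1 := by
  rw [← norm_mul, h.deriv_mul_deriv hz, norm_one]

lemma mono (h : HoloInverse φ ψ x R) {y : ℂ} {r : ℝ} (hr : 0 < r) (hb : ball y r ⊆ ball x R) :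
    HoloInverse φ ψ y r :=
  ⟨hr, h.holo.mono hb, fun z hz => h.inv z (hb hz), fun z hz => h.inv_holo z (hb hz)⟩

lemma isOpen_image (h : HoloInverse φ ψ x R) : IsOpen (φ '' ball x R) := by
  rw [isOpen_iff_mem_nhds]
  rintro _ ⟨z, hz, rfl⟩
  have h1 : HasStrictDerivAt φ (deriv φ z) z :=
    ((h.holo.analyticAt (isOpen_ball.mem_nhds hz))).hasStrictDerivAt
  rw [← h1.map_nhds_eq (h.deriv_ne_zero hz)]
  exact image_mem_map (isOpen_ball.mem_nhds hz)

lemma inv_differentiableOn (h : HoloInverse φ ψ x R) {s : Set ℂ} (hs : s ⊆ φ '' ball x R) :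
    DifferentiableOn ℂ ψ s := by
  intro w hw
  obtain ⟨z, hz, rfl⟩ := hs hw
  exact (h.inv_holo z hz).differentiableWithinAt

lemma inv_mem (h : HoloInverse φ ψ x R) {w : ℂ} (hw : w ∈ φ '' ball x R) :
    ψ w ∈ ball x R ∧ φ (ψ w) = w := by
  obtain ⟨z, hz, rfl⟩ := hw
  rw [h.inv z hz]
  exact ⟨hz, rfl⟩

/-- A weak form of the Koebe quarter theorem, for a value at least distance from the centre. -/
lemma deriv_le_of_ball_subset (h : HoloInverse φ ψ x R) {a : ℂ} (ha : a ∉ φ '' ball x R)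
    (hb : ball (φ x) (dist a (φ x)) ⊆ φ '' ball x R) : R * ‖deriv φ x‖ / 32 ≤ dist a (φ x) := by
  have hx : x ∈ ball x R := mem_ball_self h.pos
  have hne : ∀ z ∈ ball x R, φ z - a ≠ 0 := fun z hz h0 =>
    ha ⟨z, hz, sub_eq_zero.1 h0⟩
  have hda : 0 < dist a (φ x) := dist_pos.2 fun h0 => ha ⟨x, hx, h0.symm⟩
  -- a holomorphic square root of `(φ - a) / (φ x - a)`
  obtain ⟨L, hLx, hL⟩ := (((h.holo.deriv isOpen_ball).div (h.holo.sub_const a)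
    hne).isExactOn_ball).with_val_at x 0
  set k : ℂ → ℂ := fun z => Complex.exp (L z / 2) with hk
  have hkd : ∀ z ∈ ball x R, HasDerivAt k (k z * (deriv φ z / (φ z - a) / 2)) z := fun z hz =>
    ((hL z hz).div_const 2).cexp
  have hkx : k x = 1 := by simp [hk, hLx]
  have hksq : ∀ z ∈ ball x R, φ z - a = (φ x - a) * k z ^ 2 := by
    intro z hz
    have hconst : ∀ w ∈ ball x R,
        HasDerivWithinAt (fun w => (φ w - a) * Complex.exp (-L w)) 0 (ball x R) w := by
      intro w hw
      have h1 := (((h.differentiableAt hw).hasDerivAt.sub_const a).mul (hL w hw).neg.cexp)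
      refine (h1.congr_deriv ?_).hasDerivWithinAt
      have := hne w hw
      simp only [Pi.neg_apply, Pi.div_apply]
      field_simp
      ring
    have h2 := (convex_ball x R).is_const_of_fderivWithin_eq_zero (𝕜 := ℂ)
      (f := fun w => (φ w - a) * Complex.exp (-L w))
      (fun w hw => (hconst w hw).differentiableWithinAt)
      (fun w hw => by
        have := (hconst w hw).hasFDerivWithinAt.fderivWithin (isOpen_ball.uniqueDiffWithinAt hw)
        rw [this]; ext; simp) hz hx
    simp only [hLx, neg_zero, Complex.exp_zero, mul_one] at h2
    rw [← h2, hk]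
    simp only [← Complex.exp_nat_mul]
    rw [mul_assoc, ← Complex.exp_add]
    norm_num
    rw [show -L z + 2 * (L z / 2) = 0 by ring, Complex.exp_zero, mul_one]
  -- `k` assumes every value near `1`, hence no value near `-1`
  set ω : ℂ → ℂ := fun v => ψ (a + (φ x - a) * v ^ 2) with hω
  -- The radius 1/3 works because |v² - 1| ≤ |v - 1| (|v - 1| + 2) < 7/9.
  have hmem : ∀ v ∈ ball (1 : ℂ) (1 / 3), a + (φ x - a) * v ^ 2 ∈ φ '' ball x R := by
    intro v hv
    apply hb
    rw [mem_ball, dist_eq_norm]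
    rw [mem_ball, dist_eq_norm] at hv
    have e1 : a + (φ x - a) * v ^ 2 - φ x = (φ x - a) * ((v - 1) * ((v - 1) + 2)) := by ring
    rw [e1, norm_mul, norm_mul, ← dist_eq_norm (φ x) a, dist_comm (φ x) a]
    have h3 : ‖(v - 1) + 2‖ ≤ 1 / 3 + 2 := (norm_add_le _ _).trans (by
      have : ‖(2 : ℂ)‖ = 2 := by norm_num
      rw [this]; linarith)
    have h4 : ‖v - 1‖ * ‖v - 1 + 2‖ < 1 := by
      nlinarith [norm_nonneg (v - 1), norm_nonneg (v - 1 + 2)]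
    nlinarith
  have hωmem : ∀ v ∈ ball (1 : ℂ) (1 / 3), ω v ∈ ball x R ∧ k (ω v) ^ 2 = v ^ 2 := by
    intro v hv
    obtain ⟨h1, h2⟩ := h.inv_mem (hmem v hv)
    refine ⟨h1, ?_⟩
    have h3 := hksq _ h1
    rw [h2, add_sub_cancel_left] at h3
    exact (mul_left_cancel₀ (hne x hx) h3).symm
  have hkω : EqOn (k ∘ ω) id (ball (1 : ℂ) (1 / 3)) := by
    have hωc : ContinuousOn ω (ball (1 : ℂ) (1 / 3)) := by
      refine (h.inv_differentiableOn subset_rfl).continuousOn.comp (by fun_prop) hmem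
    have hkc : ContinuousOn k (ball x R) := fun z hz =>
      (hkd z hz).continuousAt.continuousWithinAt
    have hn0 : ∀ {v : ℂ}, v ∈ ball (1 : ℂ) (1 / 3) → id v ≠ 0 := by
      intro v hv h0
      rw [id] at h0
      rw [h0, mem_ball, dist_eq_norm] at hv
      norm_num at hv
    rcases (convex_ball (1 : ℂ) (1 / 3)).isPreconnected.eq_or_eq_neg_of_sq_eq
      (hkc.comp hωc fun v hv => (hωmem v hv).1) continuousOn_id
      (fun v hv => by simpa using (hωmem v hv).2) hn0 with h1 | h1
    · exact h1
    · have h2 := h1 (mem_ball_self (by norm_num : (0 : ℝ) < 1 / 3))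
      have h3 : ω 1 = x := by simp [hω, h.inv x hx]
      simp only [Function.comp, h3, hkx, Pi.neg_apply, id] at h2
      norm_num at h2
  -- `k ^ 2` determines `φ`, hence the point, so the nonvanishing `k` cannot take both `v` and `-v`.
  have homit : ∀ z ∈ ball x R, 1 / 3 ≤ ‖k z + 1‖ := by
    intro z hz
    by_contra! hlt
    have hv : -k z ∈ ball (1 : ℂ) (1 / 3) := by
      rw [mem_ball, dist_eq_norm, ← norm_neg]; simpa [add_comm] using hlt
    have h1 : k (ω (-k z)) = -k z := hkω hv
    have h2 : φ (ω (-k z)) = φ z := by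
      have e1 := hksq _ (hωmem _ hv).1
      have e2 := hksq _ hz
      rw [h1, neg_sq, ← e2] at e1
      exact sub_left_injective e1
    have h3 : ω (-k z) = z := by
      rw [← h.inv _ (hωmem _ hv).1, h2, h.inv z hz]
    rw [h3] at h1
    have h4 : k z ≠ 0 := Complex.exp_ne_zero _
    exact h4 (self_eq_neg.1 h1)
  -- Cauchy's estimate for `1 / (1 + k)`
  have hk1 : ∀ z ∈ ball x R, k z + 1 ≠ 0 := fun z hz h0 => by
    have := homit z hz
    rw [h0, norm_zero] at this
    norm_num at this
  have hH : ∀ z ∈ ball x R, ‖(k z + 1)⁻¹‖ ≤ 3 := fun z hz => by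
    rw [norm_inv]
    exact (inv_anti₀ (by norm_num) (homit z hz)).trans (by norm_num)
  have hHd := ((hkd x hx).add_const 1).inv (hk1 x hx)
  -- The oscillation bound 4 is 3 + 1; the derivative of `1 / (1 + k)` at `x` has modulus |φ'(x)| /
  -- (8 dist), whence 32 = 8 · 4.
  have hS := Complex.norm_deriv_le_div_of_mapsTo_ball (f := fun z => (k z + 1)⁻¹) (R₂ := 4)
    (fun z hz => (((hkd z hz).add_const 1).inv (hk1 z hz)).differentiableAt.differentiableWithinAt)
    (fun z hz => by
      rw [mem_closedBall, dist_eq_norm]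
      refine (norm_sub_le _ _).trans ?_
      have e : ‖(k x + 1)⁻¹‖ ≤ 1 := by rw [hkx]; norm_num
      linarith [hH z hz]) h.pos
  have hHd' : deriv (fun z => (k z + 1)⁻¹) x = _ := hHd.deriv
  rw [hHd', hkx] at hS
  have e2 : ‖-(1 * (deriv φ x / (φ x - a) / 2)) / (1 + 1 : ℂ) ^ 2‖
      = ‖deriv φ x‖ / (8 * dist a (φ x)) := by
    rw [dist_comm, dist_eq_norm]
    simp only [norm_div, norm_neg, one_mul, norm_pow]
    norm_num
    field_simp
    ring
  rw [e2, div_le_div_iff₀ (by positivity) h.pos] at hS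
  linarith

/-- A weak form of the Koebe quarter theorem. -/
lemma ball_subset_image (h : HoloInverse φ ψ x R) :
    ball (φ x) (R * ‖deriv φ x‖ / 32) ⊆ φ '' ball x R := by
  intro w hw
  by_contra hwW
  have hcl : IsClosed (φ '' ball x R)ᶜ := h.isOpen_image.isClosed_compl
  obtain ⟨a, haW, had⟩ := hcl.exists_infDist_eq_dist ⟨w, hwW⟩ (φ x)
  have hb : ball (φ x) (dist a (φ x)) ⊆ φ '' ball x R := by
    intro z hz
    by_contra hzW
    have := infDist_le_dist_of_mem (x := φ x) (s := (φ '' ball x R)ᶜ) hzW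
    rw [had, dist_comm, dist_comm (φ x) z] at this
    exact absurd (mem_ball.1 hz) (not_lt.2 this)
  have h1 := h.deriv_le_of_ball_subset haW hb
  have h2 := infDist_le_dist_of_mem (x := φ x) (s := (φ '' ball x R)ᶜ) hwW
  rw [had, dist_comm, dist_comm (φ x) w] at h2
  exact absurd (mem_ball.1 hw) (not_lt.2 (h1.trans h2))

/-- The inverse maps small discs into discs of comparable size. -/
lemma inv_mapsTo (h : HoloInverse φ ψ x R) {s : ℝ} (hs : s ≤ R * ‖deriv φ x‖ / 32) :
    MapsTo ψ (ball (φ x) s) (ball x (s * (32 / ‖deriv φ x‖))) := by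
  intro w hw
  have hx : x ∈ ball x R := mem_ball_self h.pos
  have hd := h.norm_deriv_pos hx
  have hR := h.pos
  have hw' : w ∈ ball (φ x) (R * ‖deriv φ x‖ / 32) := ball_subset_ball hs hw
  have h1 := Complex.dist_le_div_mul_dist_of_mapsTo_ball (f := ψ) (R₂ := R)
    (h.inv_differentiableOn h.ball_subset_image)
    (fun z hz => by
      rw [h.inv x hx]
      exact ball_subset_closedBall (h.inv_mem (h.ball_subset_image hz)).1) hw'
  rw [h.inv x hx] at h1
  rw [mem_ball]
  refine h1.trans_lt ?_
  have e : R / (R * ‖deriv φ x‖ / 32) = 32 / ‖deriv φ x‖ := by field_simp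
  rw [e, mul_comm]
  exact mul_lt_mul_of_pos_right hw (by positivity)

/-- If the image contained the whole disc of radius 3R|φ'(y)|, the Schwarz lemma for `ψ`, whose
values lie within 2R of `y`, would give |ψ'| |φ'| ≤ 2/3, although this product is 1. -/
lemma exists_omitted (h : HoloInverse φ ψ x R) {y : ℂ} (hy : y ∈ ball x R) :
    ∃ w, w ∉ φ '' ball x R ∧ dist w (φ y) ≤ 3 * R * ‖deriv φ y‖ := by
  by_contra! hcon
  have hd := h.norm_deriv_pos hy
  have hR := h.pos
  set d := 3 * R * ‖deriv φ y‖ with hdd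
  have hdpos : 0 < d := by positivity
  have hsub : ball (φ y) d ⊆ φ '' ball x R := by
    intro w hw
    by_contra hwW
    exact absurd (mem_ball.1 hw) (not_lt.2 (hcon w hwW).le)
  have h1 := Complex.norm_deriv_le_div_of_mapsTo_ball (f := ψ) (R₂ := 2 * R)
    (h.inv_differentiableOn hsub) (fun z hz => by
      rw [h.inv y hy, mem_closedBall]
      have e1 := (h.inv_mem (hsub hz)).1
      have := dist_triangle_right (ψ z) y x
      rw [mem_ball] at e1 hy
      linarith) hdpos
  rw [le_div_iff₀ hdpos] at h1
  have h2 := h.norm_deriv_inv hy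
  nlinarith

/-- Outside points see `φ` grow at most polynomially towards the boundary. -/
lemma growth (h : HoloInverse φ ψ x R) {w : ℂ} (hw : w ∉ φ '' ball x R) {y : ℂ}
    (hy : y ∈ ball x R) :
    dist (φ y) w ≤ (R / (R - dist y x)) ^ 32 * dist (φ x) w ∧
      dist (φ x) w ≤ (R / (R - dist y x)) ^ 32 * dist (φ y) w := by
  have hR := h.pos
  rw [mem_ball] at hy
  have hb : 0 < R - dist y x := by linarith
  obtain ⟨ζ, hζ, hyζ⟩ : ∃ ζ : ℂ, ‖ζ‖ = 1 ∧ y = x + ζ * dist y x := by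
    by_cases hxy : y = x
    · exact ⟨1, by simp, by simp [hxy]⟩
    · have : (dist y x : ℂ) ≠ 0 := by exact_mod_cast (dist_pos.2 hxy).ne'
      refine ⟨(y - x) / dist y x, ?_, by field_simp; ring⟩
      rw [norm_div, Complex.norm_real, Real.norm_of_nonneg dist_nonneg, dist_eq_norm,
        div_self (norm_ne_zero_iff.2 (sub_ne_zero.2 hxy))]
  set T := Real.log (R / (R - dist y x)) with hT
  have hT0 : 0 ≤ T := Real.log_nonneg (by rw [le_div_iff₀ hb]; linarith [dist_nonneg (x := y) (y := x)])
  -- The radius from `x` to `y`, in a time for which the distance to the boundary circle is R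
  -- exp(-τ). The quarter theorem on the remaining disc then bounds the logarithmic derivative of `φ
  -- - w` by the constant 32, and Grönwall applies; the reverse inequality comes from running the
  -- path backwards.
  set c : ℝ → ℂ := fun τ => x + ζ * (R * (1 - Real.exp (-τ)) : ℝ) with hc
  have hcd : ∀ τ, HasDerivAt c (ζ * (R * Real.exp (-τ) : ℝ)) τ := by
    intro τ
    have h1 : HasDerivAt (fun τ : ℝ => R * (1 - Real.exp (-τ))) (R * Real.exp (-τ)) τ := by
      have := ((hasDerivAt_neg τ).exp.const_sub 1).const_mul R
      simpa using this
    exact ((h1.ofReal_comp).const_mul ζ).const_add x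
  have hdist : ∀ τ, 0 ≤ τ → dist (c τ) x = R - R * Real.exp (-τ) := by
    intro τ hτ
    have : 0 ≤ R * (1 - Real.exp (-τ)) := by
      have : Real.exp (-τ) ≤ 1 := Real.exp_le_one_iff.2 (by linarith)
      exact mul_nonneg hR.le (by linarith)
    simp only [hc]
    rw [dist_eq_norm, add_sub_cancel_left, norm_mul, hζ, one_mul, Complex.norm_real,
      Real.norm_of_nonneg this]
    ring
  have hball : ∀ τ, 0 ≤ τ → c τ ∈ ball x R := by
    intro τ hτ
    rw [mem_ball, hdist τ hτ]
    have := mul_pos hR (Real.exp_pos (-τ)); linarith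
  have hc0 : c 0 = x := by simp [hc]
  have hcT : c T = y := by
    have : Real.exp (-T) = (R - dist y x) / R := by
      rw [Real.exp_neg, hT, Real.exp_log (by positivity), inv_div]
    rw [hc]
    simp only [this]
    conv_rhs => rw [hyζ]
    congr 3
    field_simp; ring
  have hbound : ∀ τ, 0 ≤ τ →
      ‖deriv φ (c τ) * (ζ * (R * Real.exp (-τ) : ℝ))‖ ≤ 32 * ‖φ (c τ) - w‖ := by
    intro τ hτ
    have hr : 0 < R * Real.exp (-τ) := mul_pos hR (Real.exp_pos _)
    have hsub : ball (c τ) (R * Real.exp (-τ)) ⊆ ball x R :=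
      ball_subset_ball' (by rw [hdist τ hτ]; linarith)
    have h1 := (h.mono hr hsub).ball_subset_image.trans (image_mono hsub)
    have h2 : ¬ w ∈ ball (φ (c τ)) (R * Real.exp (-τ) * ‖deriv φ (c τ)‖ / 32) :=
      fun h3 => hw (h1 h3)
    rw [mem_ball, not_lt, dist_comm, dist_eq_norm] at h2
    rw [norm_mul, norm_mul, hζ, one_mul, Complex.norm_real, Real.norm_of_nonneg hr.le]
    linarith
  have hed : ∀ τ, 0 ≤ τ → HasDerivAt (fun τ => φ (c τ) - w)
      (deriv φ (c τ) * (ζ * (R * Real.exp (-τ) : ℝ))) τ := fun τ hτ =>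
    ((h.differentiableAt (hball τ hτ)).hasDerivAt.comp_of_eq τ (hcd τ) rfl).sub_const w
  have hexp : Real.exp (32 * T) = (R / (R - dist y x)) ^ 32 := by
    rw [show 32 * T = (32 : ℕ) * T by norm_num, Real.exp_nat_mul, hT,
      Real.exp_log (by positivity)]
  constructor
  · have := norm_le_gronwallBound_of_norm_deriv_right_le (f := fun τ => φ (c τ) - w)
      (f' := fun τ => deriv φ (c τ) * (ζ * (R * Real.exp (-τ) : ℝ))) (K := 32) (ε := 0)
      (a := 0) (b := T) (δ := ‖φ x - w‖)
      (fun τ hτ => (hed τ hτ.1).continuousAt.continuousWithinAt)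
      (fun τ hτ => (hed τ hτ.1).hasDerivWithinAt) (by simp [hc0])
      (fun τ hτ => by simpa using hbound τ hτ.1) T ⟨hT0, le_rfl⟩
    simp only [hcT, sub_zero, gronwallBound_ε0] at this
    rw [hexp] at this
    rw [dist_eq_norm (φ _) w, dist_eq_norm (φ _) w, mul_comm]; exact this
  · have hrev : ∀ τ, τ ≤ T → HasDerivAt (fun τ => φ (c (T - τ)) - w)
        (-(deriv φ (c (T - τ)) * (ζ * (R * Real.exp (-(T - τ)) : ℝ)))) τ := by
      intro τ hτ
      have h1 : HasDerivAt (fun τ : ℝ => T - τ) (-1) τ := by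
        simpa using (hasDerivAt_id τ).const_sub T
      have := (hed (T - τ) (by linarith)).scomp τ h1
      rwa [neg_one_smul] at this
    have := norm_le_gronwallBound_of_norm_deriv_right_le (f := fun τ => φ (c (T - τ)) - w)
      (f' := fun τ => -(deriv φ (c (T - τ)) * (ζ * (R * Real.exp (-(T - τ)) : ℝ)))) (K := 32)
      (ε := 0) (a := 0) (b := T) (δ := ‖φ y - w‖)
      (fun τ hτ => (hrev τ hτ.2).continuousAt.continuousWithinAt)
      (fun τ hτ => (hrev τ hτ.2.le).hasDerivWithinAt) (by simp [hcT])
      (fun τ hτ => by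
        rw [norm_neg]
        simpa using hbound (T - τ) (by linarith [hτ.2])) T ⟨hT0, le_rfl⟩
    simp only [sub_self, hc0, sub_zero, gronwallBound_ε0] at this
    rw [hexp] at this
    rw [dist_eq_norm (φ _) w, dist_eq_norm (φ _) w, mul_comm]; exact this

/-- Both points are compared with an omitted value at distance at most 3R|φ'(x)| from `φ x`; 6 is 3
· 2. -/
lemma dist_image_le (h : HoloInverse φ ψ x R) {y : ℂ} (hy : y ∈ ball x R) :
    dist (φ y) (φ x) ≤ 6 * (R / (R - dist y x)) ^ 32 * (R * ‖deriv φ x‖) := by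
  obtain ⟨w, hw, hwd⟩ := h.exists_omitted (mem_ball_self h.pos)
  have h1 := (h.growth hw hy).1
  have hR := h.pos
  rw [mem_ball] at hy
  have hb : 0 < R - dist y x := by linarith
  have hP : 1 ≤ (R / (R - dist y x)) ^ 32 := one_le_pow₀ (by
    rw [le_div_iff₀ hb]; linarith [dist_nonneg (x := y) (y := x)])
  have h2 := dist_triangle_right (φ y) (φ x) w
  rw [dist_comm w] at hwd
  have h3 : 0 ≤ R * ‖deriv φ x‖ := by positivity
  nlinarith [dist_nonneg (x := φ x) (y := w)]

/-- An omitted value near `φ y` is still at least R|φ'(x)| / 32 from `φ x`; `growth` compares the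
two distances, and 96 = 3 · 32. -/
lemma norm_deriv_le (h : HoloInverse φ ψ x R) {y : ℂ} (hy : y ∈ ball x R) :
    ‖deriv φ x‖ ≤ 96 * (R / (R - dist y x)) ^ 32 * ‖deriv φ y‖ := by
  obtain ⟨w, hw, hwd⟩ := h.exists_omitted hy
  have h1 := (h.growth hw hy).2
  have h2 : ¬ w ∈ ball (φ x) (R * ‖deriv φ x‖ / 32) := fun h3 => hw (h.ball_subset_image h3)
  have hR := h.pos
  rw [mem_ball] at hy
  have hb : 0 < R - dist y x := by linarith
  have hP : 0 ≤ (R / (R - dist y x)) ^ 32 := by positivity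
  rw [mem_ball, not_lt, dist_comm] at h2
  rw [dist_comm w] at hwd
  have h3 := mul_le_mul_of_nonneg_left hwd hP
  have h4 : R * ‖deriv φ x‖ ≤ R * (96 * (R / (R - dist y x)) ^ 32 * ‖deriv φ y‖) := by linarith
  exact le_of_mul_le_mul_left h4 hR

end HoloInverse

/-! ### Pulling discs back along an orbit -/

/-- `φ` is the branch of `F^{-k}` on the disc of radius `ρ` about `x n` that follows the orbit `x`
backwards, inside the domain `U` of `F`. -/
structure IsBranch (F : ℂ → ℂ) (U : Set ℂ) (x : ℕ → ℂ) (n k : ℕ) (ρ : ℝ) (φ : ℂ → ℂ) : Prop where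
  holo : DifferentiableOn ℂ φ (ball (x n) ρ)
  base : φ (x n) = x (n - k)
  mem : ∀ z ∈ ball (x n) ρ, ∀ i < k, F^[i] (φ z) ∈ U
  inv : ∀ z ∈ ball (x n) ρ, F^[k] (φ z) = z

/-- A bounded orbit `x` of a holomorphic map `F : U → ℂ` such that small inverse branches along the
orbit can be continued as long as they avoid `x 0`. -/
structure PlanarOrbit (F : ℂ → ℂ) (U : Set ℂ) (x : ℕ → ℂ) (ρ₀ : ℝ) : Prop where
  isOpen : IsOpen U
  holo : DifferentiableOn ℂ F U
  mem : ∀ n, x n ∈ U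
  map : ∀ n, F (x n) = x (n + 1)
  bounded : Bornology.IsBounded (range x)
  pos : 0 < ρ₀
  lift : ∀ n k ρ φ, 0 < ρ → ρ ≤ ρ₀ → k < n → IsBranch F U x n k ρ φ → x 0 ∉ φ '' ball (x n) ρ →
    ∃ φ', IsBranch F U x n (k + 1) ρ φ'

/-- Some iterate of `F` maps a disc centred at the orbit well inside itself. -/
def Contracts (F : ℂ → ℂ) (U : Set ℂ) (x : ℕ → ℂ) : Prop :=
  ∃ (t m : ℕ) (s : ℝ), 0 < m ∧ 0 < s ∧ (∀ z ∈ ball (x t) s, ∀ i < m, F^[i] z ∈ U) ∧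
    MapsTo F^[m] (ball (x t) s) (ball (x t) (s / 4))

/-- The loss of distortion in an inverse branch of depth `k`. -/
def stepLoss (k : ℕ) : ℝ := 49152 * (2 * ((k : ℝ) + 2) ^ 2) ^ 33

lemma differentiableAt_iterate {F : ℂ → ℂ} {U : Set ℂ} (hU : IsOpen U)
    (hF : DifferentiableOn ℂ F U) (k : ℕ) {w : ℂ} (hw : ∀ i < k, F^[i] w ∈ U) :
    DifferentiableAt ℂ F^[k] w := by
  induction k with
  | zero => exact differentiableAt_id
  | succ k ih =>
    rw [Function.iterate_succ']
    exact (hF.differentiableAt (hU.mem_nhds (hw k k.lt_succ_self))).comp w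
      (ih fun i hi => hw i (hi.trans k.lt_succ_self))

namespace PlanarOrbit

variable {F : ℂ → ℂ} {U : Set ℂ} {x : ℕ → ℂ} {ρ₀ : ℝ}

lemma iterate (h : PlanarOrbit F U x ρ₀) (k n : ℕ) : F^[k] (x n) = x (n + k) := by
  induction k with
  | zero => rfl
  | succ k ih => rw [Function.iterate_succ_apply', ih, h.map]; rfl

lemma differentiableAt (h : PlanarOrbit F U x ρ₀) (k n : ℕ) : DifferentiableAt ℂ F^[k] (x n) :=
  differentiableAt_iterate h.isOpen h.holo k fun i _ => by rw [h.iterate]; exact h.mem _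

lemma holoInverse (h : PlanarOrbit F U x ρ₀) {n k : ℕ} {ρ : ℝ} {φ : ℂ → ℂ} (hρ : 0 < ρ)
    (hb : IsBranch F U x n k ρ φ) : HoloInverse φ F^[k] (x n) ρ :=
  ⟨hρ, hb.holo, hb.inv, fun z hz => differentiableAt_iterate h.isOpen h.holo k (hb.mem z hz)⟩

/-- Pulling a disc back along the orbit, with slowly shrinking radii, until it swallows `x 0`. -/
lemma exists_branch (h : PlanarOrbit F U x ρ₀) {t : ℕ} {ρ : ℝ} (hρ : 0 < ρ) (hρ₀ : ρ ≤ ρ₀)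
    (hδ : ρ ≤ dist (x t) (x 0)) :
    ∃ k φ, 1 ≤ k ∧ k ≤ t ∧ IsBranch F U x t k (ρ / 2 * (1 + 1 / ((k : ℝ) + 1))) φ ∧
      x 0 ∈ φ '' ball (x t) (ρ / 2 * (1 + 1 / ((k : ℝ) + 2))) := by
  have hrad : ∀ k : ℕ, ρ / 2 * (1 + 1 / ((k : ℝ) + 2)) ≤ ρ / 2 * (1 + 1 / ((k : ℝ) + 1)) := by
    intro k; gcongr; linarith
  have hle : ∀ k : ℕ, ρ / 2 * (1 + 1 / ((k : ℝ) + 2)) ≤ ρ := by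
    intro k
    have : 1 / ((k : ℝ) + 2) ≤ 1 := by rw [div_le_one (by positivity)]; linarith [k.cast_nonneg (α := ℝ)]
    nlinarith
  by_contra! hcon
  have key : ∀ k : ℕ, k ≤ t → ∃ φ, IsBranch F U x t k (ρ / 2 * (1 + 1 / ((k : ℝ) + 1))) φ := by
    intro k
    induction k with
    | zero =>
      exact fun _ => ⟨id, differentiableOn_id, rfl, fun z _ i hi => absurd hi (Nat.not_lt_zero i),
        fun z _ => rfl⟩
    | succ k ih =>
      intro hk
      obtain ⟨φ, hφ⟩ := ih (by omega)
      have hsub : ball (x t) (ρ / 2 * (1 + 1 / ((k : ℝ) + 2))) ⊆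
          ball (x t) (ρ / 2 * (1 + 1 / ((k : ℝ) + 1))) := ball_subset_ball (hrad k)
      have hφ' : IsBranch F U x t k (ρ / 2 * (1 + 1 / ((k : ℝ) + 2))) φ :=
        ⟨hφ.holo.mono hsub, hφ.base, fun z hz => hφ.mem z (hsub hz), fun z hz => hφ.inv z (hsub hz)⟩
      -- At depth 0 the branch is the identity and `ρ ≤ dist (x t) (x 0)` keeps `x 0` outside; this
      -- is what forces `1 ≤ k`.
      have hx0 : x 0 ∉ φ '' ball (x t) (ρ / 2 * (1 + 1 / ((k : ℝ) + 2))) := by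
        rcases Nat.eq_zero_or_pos k with rfl | hk1
        · rintro ⟨z, hz, hz0⟩
          have h1 : φ z = z := hφ.inv z (hsub hz)
          rw [h1] at hz0
          rw [hz0, mem_ball, dist_comm] at hz
          exact absurd (hz.trans_le (hle 0)) (not_lt.2 hδ)
        · exact hcon k φ hk1 (by omega) hφ
      obtain ⟨φ', h'⟩ := h.lift t k _ φ (by positivity) ((hle k).trans hρ₀) (by omega) hφ' hx0
      refine ⟨φ', ?_⟩
      have e : ((k + 1 : ℕ) : ℝ) + 1 = (k : ℝ) + 2 := by push_cast; ring
      rwa [e]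
  obtain ⟨φ, hφ⟩ := key t le_rfl
  rcases Nat.eq_zero_or_pos t with rfl | ht
  · rw [dist_self] at hδ; linarith
  -- At depth `t` the base point of the branch is `x 0` itself, so the pullback stops by then.
  · refine hcon t φ ht le_rfl hφ ⟨x t, mem_ball_self (by positivity), ?_⟩
    rw [hφ.base, Nat.sub_self]

/-- One step of the backward construction. -/
lemma exists_step (h : PlanarOrbit F U x ρ₀) (hnc : ¬ Contracts F U x) {t : ℕ} {ρ : ℝ}
    (hρ : 0 < ρ) (hρ₀ : ρ ≤ ρ₀) (hδ : ρ ≤ dist (x t) (x 0)) :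
    ∃ k l, 1 ≤ k ∧ k ≤ t ∧ 0 < l ∧ l = ‖deriv F^[k] (x (t - k))‖ ∧
      (∀ s, s * (64 * l) ≤ ρ → (∀ z ∈ ball (x (t - k)) s, ∀ i < k, F^[i] z ∈ U) ∧
        MapsTo F^[k] (ball (x (t - k)) s) (ball (x t) (s * (64 * l)))) ∧
      dist (x (t - k)) (x 0) * l ≤ stepLoss k * ρ ∧
      ρ ≤ stepLoss k * l * dist (x t) (x 0) ∧
      dist (x k) (x 0) < 2 * dist (x t) (x 0) := by
  obtain ⟨k, φ, hk1, hkt, hφ, y, hy, hy0⟩ := h.exists_branch hρ hρ₀ hδ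
  set R := ρ / 2 * (1 + 1 / ((k : ℝ) + 1)) with hR
  have hRpos : 0 < R := by positivity
  have hRlo : ρ / 2 ≤ R := by
    rw [hR]; have : 0 < 1 / ((k : ℝ) + 1) := by positivity
    nlinarith
  have hRhi : R ≤ ρ := by
    have : 1 / ((k : ℝ) + 1) ≤ 1 := by
      rw [div_le_one (by positivity)]; linarith [k.cast_nonneg (α := ℝ)]
    rw [hR]; nlinarith
  have hI := h.holoInverse hRpos hφ
  -- The preimage `y` of `x 0` lies in the next smaller disc; the gap between consecutive radii, ρ /
  -- (2(k+1)(k+2)), makes the distortion polynomial in `k`.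
  have hB : R / (2 * ((k : ℝ) + 2) ^ 2) ≤ R - dist y (x t) := by
    rw [mem_ball] at hy
    have e : R - ρ / 2 * (1 + 1 / ((k : ℝ) + 2)) = ρ / (2 * (((k : ℝ) + 1) * ((k : ℝ) + 2))) := by
      rw [hR]; field_simp; ring
    have h2 : R / (2 * ((k : ℝ) + 2) ^ 2) ≤ ρ / (2 * (((k : ℝ) + 1) * ((k : ℝ) + 2))) := by
      gcongr; nlinarith [k.cast_nonneg (α := ℝ)]
    linarith
  have hBpos : 0 < R - dist y (x t) := lt_of_lt_of_le (by positivity) hB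
  have hyR : y ∈ ball (x t) R := by rw [mem_ball]; linarith
  set Q := R / (R - dist y (x t)) with hQ
  have hQle : Q ≤ 2 * ((k : ℝ) + 2) ^ 2 := by
    rw [hQ, div_le_iff₀ hBpos]
    rw [div_le_iff₀ (by positivity)] at hB
    linarith
  have hQ1 : 1 ≤ Q := by
    rw [hQ, le_div_iff₀ hBpos]; linarith [dist_nonneg (x := y) (y := x t)]
  have hloss : 49152 * Q ^ 33 ≤ stepLoss k := by unfold stepLoss; gcongr
  have hxR : x t ∈ ball (x t) R := mem_ball_self hRpos
  have hd := hI.norm_deriv_pos hxR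
  have hdl := hI.norm_deriv_inv hxR
  set l := ‖deriv F^[k] (φ (x t))‖ with hl
  have hlpos : 0 < l := by
    by_contra! hl0
    have : l * ‖deriv φ (x t)‖ ≤ 0 := mul_nonpos_of_nonpos_of_nonneg hl0 hd.le
    linarith
  have hdeq : ‖deriv φ (x t)‖ = 1 / l := by field_simp; linarith
  refine ⟨k, l, hk1, hkt, hlpos, by rw [hl, hφ.base], fun s hs => ?_, ?_, ?_, ?_⟩
  -- 64 is the Koebe constant 32 times the loss 2 in `ρ / 2 ≤ R`.
  · have hs1 : s ≤ R * ‖deriv φ (x t)‖ / 32 := by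
      rw [hdeq, mul_one_div, div_div, le_div_iff₀ (by positivity)]; linarith
    have hsub : ball (φ (x t)) s ⊆ φ '' ball (x t) R :=
      (ball_subset_ball hs1).trans hI.ball_subset_image
    rw [hφ.base] at hsub
    refine ⟨fun z hz i hi => ?_, fun z hz => ?_⟩
    · obtain ⟨w, hw, rfl⟩ := hsub hz
      exact hφ.mem w hw i hi
    · have h1 := hI.inv_mapsTo hs1
      rw [hφ.base] at h1
      refine ball_subset_ball ?_ (h1 hz)
      rw [hdeq]
      have hs0 : 0 < s := pos_of_mem_ball hz
      have : s * (32 / (1 / l)) = s * (32 * l) := by field_simp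
      rw [this]; nlinarith [mul_pos hs0 hlpos]
  · have h1 := hI.dist_image_le hyR
    rw [hy0, hφ.base, hdeq, dist_comm] at h1
    calc dist (x (t - k)) (x 0) * l ≤ 6 * Q ^ 32 * (R * (1 / l)) * l := by gcongr
      _ = 6 * Q ^ 32 * R := by field_simp
      _ ≤ 49152 * Q ^ 33 * ρ := by
        gcongr
        · norm_num
        · norm_num
      _ ≤ stepLoss k * ρ := by gcongr
  · set B := R - dist y (x t) with hBdef
    set s := B * ‖deriv φ y‖ / 32 with hs
    have hdy := hI.norm_deriv_pos hyR
    have hspos : 0 < s := by positivity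
    have hsubB : ball y B ⊆ ball (x t) R := ball_subset_ball' (by linarith)
    have hsub : ball (x 0) s ⊆ φ '' ball (x t) R := by
      have := (hI.mono hBpos hsubB).ball_subset_image
      rw [hy0] at this
      exact this.trans (image_mono hsubB)
    -- `F^[k]` maps the disc of radius `s` about `x 0` into the disc of radius `R` about `x t`; were
    -- `s` larger, that disc would lie in the one of radius `s / 4` about `x 0`, a contraction.
    have hlt : s / 4 < R + dist (x t) (x 0) := by
      by_contra! hge
      refine hnc ⟨0, k, s, hk1, hspos, fun z hz i hi => ?_, fun z hz => ?_⟩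
      · obtain ⟨w, hw, rfl⟩ := hsub hz
        exact hφ.mem w hw i hi
      · obtain ⟨w, hw, rfl⟩ := hsub hz
        rw [hφ.inv w hw]
        rw [mem_ball] at hw ⊢
        linarith [dist_triangle w (x t) (x 0)]
    have h1 := hI.norm_deriv_le hyR
    have h2 : B * ‖deriv φ y‖ ≤ 256 * dist (x t) (x 0) := by
      rw [hs] at hlt; linarith
    have h3 : R * (1 / l) ≤ 24576 * Q ^ 33 * dist (x t) (x 0) := by
      calc R * (1 / l) = Q * B * (1 / l) := by rw [hQ]; field_simp
        _ ≤ Q * B * (96 * Q ^ 32 * ‖deriv φ y‖) := by rw [← hdeq]; gcongr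
        _ = 96 * Q ^ 33 * (B * ‖deriv φ y‖) := by ring
        _ ≤ 96 * Q ^ 33 * (256 * dist (x t) (x 0)) := by gcongr
        _ = _ := by ring
    rw [mul_one_div, div_le_iff₀ hlpos] at h3
    calc ρ ≤ 2 * R := by linarith
      _ ≤ 2 * (24576 * Q ^ 33 * dist (x t) (x 0) * l) := by linarith
      _ = 49152 * Q ^ 33 * (l * dist (x t) (x 0)) := by ring
      _ ≤ stepLoss k * (l * dist (x t) (x 0)) := by gcongr
      _ = _ := by ring
  -- `x k = F^[k] (x 0) = y` is within `R ≤ ρ ≤ dist (x t) (x 0)` of `x t`.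
  · have h1 := hφ.inv y hyR
    rw [hy0, h.iterate, zero_add] at h1
    rw [h1]
    rw [mem_ball] at hyR
    linarith [dist_triangle y (x t) (x 0)]

end PlanarOrbit

/-! ### Step costs and record times of a walk -/

/-- The logarithmic loss of a step of length `k`. -/
def stepCost (k : ℕ) : ℝ := Real.log (64 * stepLoss k)

lemma one_le_stepLoss (k : ℕ) : 1 ≤ stepLoss k := by
  have : 1 ≤ (2 * ((k : ℝ) + 2) ^ 2) ^ 33 := one_le_pow₀ (by nlinarith [k.cast_nonneg (α := ℝ)])
  unfold stepLoss; linarith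

lemma stepLoss_pos (k : ℕ) : 0 < stepLoss k := zero_lt_one.trans_le (one_le_stepLoss k)

lemma stepCost_eq (k : ℕ) : stepCost k = Real.log 64 + Real.log (stepLoss k) :=
  Real.log_mul (by norm_num) (stepLoss_pos k).ne'

lemma stepCost_nonneg (k : ℕ) : 0 ≤ stepCost k :=
  Real.log_nonneg (by linarith [one_le_stepLoss k])

lemma log_stepLoss_le_stepCost (k : ℕ) : Real.log (stepLoss k) ≤ stepCost k := by
  rw [stepCost_eq]; linarith [Real.log_nonneg (by norm_num : (1 : ℝ) ≤ 64)]

lemma stepCost_mono : Monotone stepCost := by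
  intro a b hab
  have h1 := stepLoss_pos a
  apply Real.log_le_log (by linarith)
  unfold stepLoss
  have : (a : ℝ) ≤ b := by exact_mod_cast hab
  gcongr

lemma eventually_stepCost_le {ε : ℝ} (hε : 0 < ε) : ∀ᶠ k : ℕ in atTop, stepCost k ≤ ε * k := by
  have h1 : ∀ k : ℕ, stepCost k =
      (Real.log 64 + Real.log 49152 + 33 * Real.log 2) + 66 * Real.log ((k : ℝ) + 2) := by
    intro k
    have : (0 : ℝ) < k + 2 := by positivity
    rw [stepCost_eq, stepLoss, Real.log_mul (by norm_num) (by positivity), Real.log_pow,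
      Real.log_mul (by norm_num) (by positivity), Real.log_pow]
    push_cast; ring
  have h2 : Tendsto (fun k : ℕ => (k : ℝ) + 2) atTop atTop :=
    tendsto_atTop_add_const_right _ _ tendsto_natCast_atTop_atTop
  have h3 := (Real.isLittleO_log_id_atTop.comp_tendsto h2).bound (c := ε / 132) (by positivity)
  have h4 : ∀ᶠ k : ℕ in atTop,
      Real.log 64 + Real.log 49152 + 33 * Real.log 2 + ε ≤ ε / 2 * k :=
    (tendsto_natCast_atTop_atTop.const_mul_atTop (by positivity)).eventually_ge_atTop _
  filter_upwards [h3, h4] with k h3 h4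
  simp only [Function.comp, id, Real.norm_eq_abs] at h3
  rw [abs_of_pos (by positivity : (0 : ℝ) < k + 2)] at h3
  have := (le_abs_self _).trans h3
  rw [h1]
  linarith

/-- Along a walk whose steps are nonnegative costs, lowered by `D` at the marked times, any deep
final level forces deep near-record marked times at all intermediate levels. -/
lemma exists_record {c : ℕ → ℝ} {M : ℕ → Prop} [DecidablePred M] {D H : ℝ} (hc : ∀ i, 0 ≤ c i)
    (hD : 0 < D) (hH : D ≤ H) {T Q : ℕ}
    (hT : ∑ j ∈ Finset.range T, (c j - if M j then D else 0) ≤ -(Q * H) - D) (b : ℕ) (hb : b ≤ Q) :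
    ∃ i < T, M i ∧ ∑ j ∈ Finset.range i, (c j - if M j then D else 0) ≤ -(b * H) ∧
      ∀ m ≤ i, -(b * H) - D < ∑ j ∈ Finset.range m, (c j - if M j then D else 0) := by
  set G : ℕ → ℝ := fun i => ∑ j ∈ Finset.range i, (c j - if M j then D else 0) with hG
  have hsucc : ∀ i, G (i + 1) = G i + (c i - if M i then D else 0) := fun i =>
    Finset.sum_range_succ _ _
  -- Only marked steps can descend, and by at most `D`; so the last marked time before `i` is at
  -- most `D` above the level at `i`.
  have hlast : ∀ i, G i < 0 → ∃ j < i, M j ∧ G j ≤ G i + D := by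
    intro i
    induction i with
    | zero => intro h; simp [hG] at h
    | succ i ih =>
      intro h
      rw [hsucc] at h ⊢
      by_cases hM : M i
      · exact ⟨i, i.lt_succ_self, hM, by simp only [hM, if_true]; linarith [hc i]⟩
      · simp only [hM, if_false] at h ⊢
        obtain ⟨j, hj, hMj, hle⟩ := ih (by linarith [hc i])
        exact ⟨j, hj.trans i.lt_succ_self, hMj, by linarith [hc i]⟩
  have hbQ : (b : ℝ) * H ≤ Q * H := by
    have : (b : ℝ) ≤ Q := by exact_mod_cast hb
    exact mul_le_mul_of_nonneg_right this (hD.le.trans hH)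
  have hb0 : 0 ≤ (b : ℝ) * H := mul_nonneg b.cast_nonneg (hD.le.trans hH)
  have hTG : G T ≤ -(Q * H) - D := hT
  have hex : ∃ i, M i ∧ G i ≤ -(b * H) := by
    obtain ⟨j, -, hMj, hle⟩ := hlast T (by linarith)
    exact ⟨j, hMj, by linarith⟩
  classical
  -- The first marked time at or below level `-bH`: earlier marked times are above it, so the walk
  -- never gets lower than `-bH - D` up to then.
  refine ⟨Nat.find hex, ?_, (Nat.find_spec hex).1, (Nat.find_spec hex).2, ?_⟩
  · obtain ⟨j, hjT, hMj, hle⟩ := hlast T (by linarith)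
    exact (Nat.find_min' hex ⟨hMj, by linarith⟩).trans_lt hjT
  · intro m
    induction m with
    | zero => intro _; simp only [Finset.range_zero, Finset.sum_empty]; linarith
    | succ m ih =>
      intro hm
      have h1 : -(b * H) - D < G m := ih (by omega)
      have h2 := Nat.find_min hex (m := m) (by omega)
      change _ < G (m + 1)
      rw [hsucc]
      by_cases hM : M m
      · have h3 : -(b * H) < G m := by
          by_contra! h3; exact h2 ⟨hM, h3⟩
        simp only [hM, if_true]; linarith [hc m]
      · simp only [hM, if_false]; linarith [hc m]

/-! ### No exponential decay without contraction -/

namespace PlanarOrbit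

variable {F : ℂ → ℂ} {U : Set ℂ} {x : ℕ → ℂ} {ρ₀ : ℝ}

lemma norm_deriv_add (h : PlanarOrbit F U x ρ₀) (a b : ℕ) :
    ‖deriv F^[a + b] (x 0)‖ = ‖deriv F^[a] (x b)‖ * ‖deriv F^[b] (x 0)‖ := by
  have h2 : F^[b] (x 0) = x b := by rw [h.iterate, zero_add]
  have h1 := (h.differentiableAt a b)
  rw [← h2] at h1
  rw [Function.iterate_add, deriv_comp _ h1 (h.differentiableAt b 0), norm_mul, h2]

set_option maxHeartbeats 1000000 in
/-- If the orbit is not periodic and never contracts, its derivatives do not decay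
exponentially. -/
theorem eventually_exp_le (h : PlanarOrbit F U x ρ₀) (hne : ∀ n, 1 ≤ n → x n ≠ x 0)
    (hnc : ¬ Contracts F U x) {χ : ℝ} (hχ : 0 < χ) :
    ∀ᶠ n : ℕ in atTop, Real.exp (-χ * n) ≤ ‖deriv F^[n] (x 0)‖ := by
  set δ : ℕ → ℝ := fun t => dist (x t) (x 0) with hδdef
  have hδpos : ∀ t, 1 ≤ t → 0 < δ t := fun t ht => dist_pos.2 (hne t ht)
  -- constants
  set ε := χ / 4 with hε
  obtain ⟨N, hN⟩ := eventually_atTop.1 (eventually_stepCost_le (by positivity : 0 < ε))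
  set C := stepCost N with hCdef
  have hC0 : 0 ≤ C := stepCost_nonneg N
  have hC : ∀ k : ℕ, stepCost k ≤ ε * k + C := by
    intro k
    rcases le_total k N with hk | hk
    · have := stepCost_mono hk
      have : 0 ≤ ε * k := by positivity
      linarith
    · linarith [hN k hk]
  -- `δ₀` is so small that the orbit returns within `2 * δ₀` of `x 0` only after time `N`; with `δ k
  -- < 2 * δ t` this makes every near step longer than the threshold for `stepCost k ≤ ε * k`.
  obtain ⟨δ₀, hδ₀, hδ₀ρ, hδ₀N⟩ : ∃ δ₀ > 0, δ₀ ≤ ρ₀ ∧ ∀ k, 1 ≤ k → k < N → 2 * δ₀ ≤ δ k := by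
    have : ∀ N : ℕ, ∃ δ₀ > 0, δ₀ ≤ ρ₀ ∧ ∀ k, 1 ≤ k → k < N → 2 * δ₀ ≤ δ k := by
      intro N
      induction N with
      | zero => exact ⟨ρ₀, h.pos, le_rfl, fun k _ hk => absurd hk (Nat.not_lt_zero k)⟩
      | succ N ih =>
        obtain ⟨d, hd, hdρ, hdN⟩ := ih
        rcases Nat.eq_zero_or_pos N with rfl | hN0
        · exact ⟨d, hd, hdρ, fun k h1 h2 => by omega⟩
        · refine ⟨min d (δ N / 2), lt_min hd (half_pos (hδpos N hN0)), (min_le_left _ _).trans hdρ,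
            fun k h1 h2 => ?_⟩
          rcases Nat.lt_succ_iff_lt_or_eq.1 h2 with h3 | rfl
          · linarith [hdN k h1 h3, min_le_left d (δ N / 2)]
          · linarith [min_le_right d (δ k / 2)]
    exact this N
  obtain ⟨Δ, hΔ₀, hΔ⟩ : ∃ Δ, δ₀ ≤ Δ ∧ ∀ t, δ t ≤ Δ := by
    obtain ⟨K, hK⟩ := isBounded_iff.1 h.bounded
    exact ⟨max δ₀ K, le_max_left _ _, fun t =>
      (hK (mem_range_self t) (mem_range_self 0)).trans (le_max_right _ _)⟩
  set B := Real.log (Δ / δ₀) with hB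
  have hB0 : 0 ≤ B := Real.log_nonneg (by rw [le_div_iff₀ hδ₀]; linarith)
  -- Large enough that `D - C` is at least half of `C + D + B`, that is, that the gain at a far time
  -- is comparable with the loss there.
  set D := 4 * C + B + 1 with hD
  have hD0 : 0 < D := by positivity
  -- the radii
  set r := δ₀ * Real.exp (-D) with hr
  have hrpos : 0 < r := by positivity
  have hrδ₀ : r ≤ δ₀ := by
    have : Real.exp (-D) ≤ 1 := Real.exp_le_one_iff.2 (by linarith)
    rw [hr]; nlinarith
  set ρ : ℕ → ℝ := fun t => if δ₀ < δ t then r else δ t with hρdef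
  have hlogr : Real.log r = Real.log δ₀ - D := by
    rw [hr, Real.log_mul hδ₀.ne' (Real.exp_ne_zero _), Real.log_exp]; ring
  have hρpos : ∀ t, 1 ≤ t → 0 < ρ t := by
    intro t ht; simp only [hρdef]; split_ifs; exacts [hrpos, hδpos t ht]
  have hρle : ∀ t, ρ t ≤ ρ₀ := by
    intro t; simp only [hρdef]; split_ifs with h1
    exacts [hrδ₀.trans hδ₀ρ, (not_lt.1 h1).trans hδ₀ρ]
  have hρδ : ∀ t, ρ t ≤ δ t := by
    intro t; simp only [hρdef]; split_ifs with h1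
    exacts [hrδ₀.trans h1.le, le_rfl]
  -- the steps
  have hstep : ∀ t, ∃ k l, (t = 0 → k = 0 ∧ l = 1) ∧ (1 ≤ t → 1 ≤ k ∧ k ≤ t ∧ 0 < l ∧
      l = ‖deriv F^[k] (x (t - k))‖ ∧
      (∀ s, s * (64 * l) ≤ ρ t → (∀ z ∈ ball (x (t - k)) s, ∀ i < k, F^[i] z ∈ U) ∧
        MapsTo F^[k] (ball (x (t - k)) s) (ball (x t) (s * (64 * l)))) ∧
      δ (t - k) * l ≤ stepLoss k * ρ t ∧
      ρ t ≤ stepLoss k * l * δ t ∧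
      δ k < 2 * δ t) := by
    intro t
    rcases Nat.eq_zero_or_pos t with rfl | ht
    · exact ⟨0, 1, fun _ => ⟨rfl, rfl⟩, fun h => by omega⟩
    · obtain ⟨k, l, hkl⟩ := h.exists_step hnc (hρpos t ht) (hρle t) (hρδ t)
      exact ⟨k, l, fun h0 => by omega, fun _ => hkl⟩
  choose k l hkl0 hkl using hstep
  have hk0 : k 0 = 0 := (hkl0 0 rfl).1
  have hl0 : l 0 = 1 := (hkl0 0 rfl).2
  have hkle : ∀ t, k t ≤ t := by
    intro t
    rcases Nat.eq_zero_or_pos t with rfl | ht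
    · rw [hk0]
    · exact (hkl t ht).2.1
  set cost : ℕ → ℝ := fun t => if t = 0 then 0 else stepCost (k t) with hcost
  have hcost0 : ∀ t, 0 ≤ cost t := by
    intro t; simp only [hcost]; split_ifs; exacts [le_rfl, stepCost_nonneg _]
  have hcost1 : ∀ t, 1 ≤ t → cost t = stepCost (k t) := fun t ht => by
    simp only [hcost]; rw [if_neg (by omega)]
  have hnotres0 : ¬ δ₀ < δ 0 := by simp [hδdef, hδ₀.le]
  have hcostle : ∀ t, cost t ≤ ε * k t + if δ₀ < δ t then C else 0 := by
    intro t
    rcases Nat.eq_zero_or_pos t with rfl | ht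
    · rw [if_neg hnotres0]; simp [hcost, hk0]
    · rw [hcost1 t ht]
      split_ifs with h1
      · exact hC _
      · rw [add_zero]
        refine hN _ ?_
        by_contra! hlt
        have := hδ₀N (k t) (hkl t ht).1 hlt
        linarith [(hkl t ht).2.2.2.2.2.2.2]
  -- The lower bound on `l`: at near times `ρ t = δ t` cancels, at far times the ratio `ρ t / δ t`
  -- is at least exp(-D - B).
  have hlogl : ∀ t, -cost t - (if δ₀ < δ t then D + B else 0) ≤ Real.log (l t) := by
    intro t
    rcases Nat.eq_zero_or_pos t with rfl | ht
    · rw [if_neg hnotres0]; simp [hcost, hl0]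
    · obtain ⟨-, -, hl, -, -, -, h1, -⟩ := hkl t ht
      have h2 := Real.log_le_log (hρpos t ht) h1
      rw [Real.log_mul (by have := stepLoss_pos (k t); positivity) (hδpos t ht).ne',
        Real.log_mul (stepLoss_pos _).ne' hl.ne'] at h2
      have h3 := log_stepLoss_le_stepCost (k t)
      rw [hcost1 t ht]
      simp only [hρdef] at h2
      split_ifs at h2 ⊢ with h4
      · rw [hlogr] at h2
        have h5 := Real.log_le_log (hδpos t ht) (hΔ t)
        rw [hB, Real.log_div (hδ₀.trans_le hΔ₀).ne' hδ₀.ne']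
        linarith
      · linarith
  -- the potential
  set ℓ : ℕ → ℝ := fun t => Real.log (min (δ t) δ₀) with hℓ
  have hℓρ : ∀ t, 1 ≤ t → Real.log (ρ t) = ℓ t - if δ₀ < δ t then D else 0 := by
    intro t ht
    simp only [hρdef, hℓ]
    split_ifs with h1
    · rw [min_eq_right h1.le, hlogr]
    · rw [min_eq_left (not_lt.1 h1), sub_zero]
  -- The upper bound on `l`, made telescoping by `ℓ`. The factor 64 is the one by which radii grow
  -- in the forward inclusion of discs.
  have hpot : ∀ t, 1 ≤ t → 1 ≤ t - k t → ℓ (t - k t) + Real.log (64 * l t) ≤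
      ℓ t + (cost t - if δ₀ < δ t then D else 0) := by
    intro t ht ht'
    obtain ⟨-, -, hl, -, -, h1, -, -⟩ := hkl t ht
    have h2 := Real.log_le_log (mul_pos (hδpos _ ht') hl) h1
    rw [Real.log_mul (hδpos _ ht').ne' hl.ne', Real.log_mul (stepLoss_pos _).ne' (hρpos t ht).ne',
      hℓρ t ht] at h2
    rw [Real.log_mul (by norm_num) hl.ne', hcost1 t ht, stepCost_eq]
    have h3 : ℓ (t - k t) ≤ Real.log (δ (t - k t)) :=
      Real.log_le_log (lt_min (hδpos _ ht') hδ₀) (min_le_left _ _)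
    linarith
  -- pigeonhole scale
  set s := δ₀ * Real.exp (-(2 * D)) with hs
  have hspos : 0 < s := by positivity
  have hlogs : Real.log s = Real.log δ₀ - 2 * D := by
    rw [hs, Real.log_mul hδ₀.ne' (Real.exp_ne_zero _), Real.log_exp]; ring
  obtain ⟨Y, hYfin, hY⟩ := totallyBounded_iff.1
    (h.bounded.isCompact_closure.totallyBounded.subset subset_closure) (s / 16) (by positivity)
  set Q := hYfin.toFinset.card with hQ
  -- Levels are known only up to `D`, so this spacing leaves a contraction by 16 between two of
  -- them.
  set H := D + Real.log 16 with hH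
  have hlog16 : 0 < Real.log 16 := Real.log_pos (by norm_num)
  have hlarge : ∀ᶠ n : ℕ in atTop, Q * H + D ≤ χ / 8 * n :=
    (tendsto_natCast_atTop_atTop.const_mul_atTop (by positivity)).eventually_ge_atTop _
  filter_upwards [hlarge] with n hn
  by_contra! hbad
  -- the path down from `n`
  set τ : ℕ → ℕ := fun i => (fun t => t - k t)^[i] n with hτ
  have hτs : ∀ i, τ (i + 1) = τ i - k (τ i) := fun i => Function.iterate_succ_apply' _ _ _
  have hτk : ∀ i, τ (i + 1) + k (τ i) = τ i := fun i => by
    rw [hτs]; exact Nat.sub_add_cancel (hkle _)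
  have hex : ∃ i, τ i = 0 := by
    have : ∀ i, τ i + i ≤ n ∨ τ i = 0 := by
      intro i
      induction i with
      | zero => left; simp [hτ]
      | succ i ih =>
        rcases Nat.eq_zero_or_pos (τ i) with h0 | h0
        · right; rw [hτs, h0, Nat.zero_sub]
        · have := (hkl _ h0).1
          have := hτk i
          omega
    rcases this (n + 1) with h1 | h1
    · omega
    · exact ⟨_, h1⟩
  classical
  set T := Nat.find hex with hTdef
  have hT0 : τ T = 0 := Nat.find_spec hex
  have hTpos : ∀ i < T, 1 ≤ τ i := fun i hi => Nat.one_le_iff_ne_zero.2 (Nat.find_min hex hi)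
  have hsumk : ∀ i, ∑ j ∈ Finset.range i, (k (τ j) : ℝ) = n - τ i := by
    intro i
    induction i with
    | zero => simp [hτ]
    | succ i ih =>
      rw [Finset.sum_range_succ, ih]
      have : ((τ (i + 1) : ℝ) + k (τ i)) = τ i := by exact_mod_cast hτk i
      linarith
  have hprod : ∀ i ≤ T, Real.log ‖deriv F^[n] (x 0)‖ =
      ∑ j ∈ Finset.range i, Real.log (l (τ j)) + Real.log ‖deriv F^[τ i] (x 0)‖ ∧
      (0 < ‖deriv F^[τ i] (x 0)‖ → 0 < ‖deriv F^[n] (x 0)‖) := by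
    intro i
    induction i with
    | zero => simp [hτ]
    | succ i ih =>
      intro hi
      obtain ⟨e1, e2⟩ := ih (by omega)
      obtain ⟨-, hle, hlp, hleq, -⟩ := hkl (τ i) (hTpos i (by omega))
      have e3 : ‖deriv F^[τ i] (x 0)‖ = l (τ i) * ‖deriv F^[τ (i + 1)] (x 0)‖ := by
        rw [hleq, ← hτs, ← h.norm_deriv_add, add_comm, hτk]
      refine ⟨?_, fun hp => e2 (by rw [e3]; positivity)⟩
      rw [e1, Finset.sum_range_succ, add_assoc, e3]
      congr 1
      -- A zero derivative, where the logarithm would not be additive, would propagate down the path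
      -- to time 0, where the derivative of the identity is 1.
      by_cases hz : ‖deriv F^[τ (i + 1)] (x 0)‖ = 0
      · exfalso
        have hzero : ∀ m, i + 1 ≤ m → m ≤ T → ‖deriv F^[τ m] (x 0)‖ = 0 := by
          intro m hm
          induction m, hm using Nat.le_induction with
          | base => exact fun _ => hz
          | succ m hm ihm =>
            intro hmT
            obtain ⟨-, -, hlp', hleq', -⟩ := hkl (τ m) (hTpos m (by omega))
            have e4 : ‖deriv F^[τ m] (x 0)‖ = l (τ m) * ‖deriv F^[τ (m + 1)] (x 0)‖ := by
              rw [hleq', ← hτs, ← h.norm_deriv_add, add_comm, hτk]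
            rw [ihm (by omega)] at e4
            exact (mul_eq_zero.1 e4.symm).resolve_left hlp'.ne'
        have := hzero T hi le_rfl
        rw [hT0] at this
        simp at this
      · rw [Real.log_mul hlp.ne' hz]
  obtain ⟨hlogn, hposn⟩ := hprod T le_rfl
  rw [hT0] at hlogn hposn
  have hid : ‖deriv F^[0] (x 0)‖ = 1 := by simp
  rw [hid, Real.log_one, add_zero] at hlogn
  have hnpos := hposn (by rw [hid]; exact one_pos)
  have hbad' : Real.log ‖deriv F^[n] (x 0)‖ < -χ * n := by
    rw [← Real.log_exp (-χ * n)]; exact Real.log_lt_log hnpos hbad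
  -- accounting
  set Rn : ℝ := ∑ j ∈ Finset.range T, (if δ₀ < δ (τ j) then 1 else 0 : ℝ) with hRn
  have hRn0 : 0 ≤ Rn := Finset.sum_nonneg fun j _ => by split_ifs <;> norm_num
  have hind : ∀ c : ℝ, ∑ j ∈ Finset.range T, (if δ₀ < δ (τ j) then c else 0) = c * Rn := by
    intro c
    rw [hRn, Finset.mul_sum]
    exact Finset.sum_congr rfl fun j _ => by split_ifs <;> simp
  have hsumcost : ∑ j ∈ Finset.range T, cost (τ j) ≤ ε * n + C * Rn := by
    calc ∑ j ∈ Finset.range T, cost (τ j)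
        ≤ ∑ j ∈ Finset.range T, (ε * k (τ j) + if δ₀ < δ (τ j) then C else 0) :=
          Finset.sum_le_sum fun j _ => hcostle _
      _ = ε * n + C * Rn := by
          rw [Finset.sum_add_distrib, ← Finset.mul_sum, hsumk, hT0, hind]; simp
  have hlow : -(ε * n + C * Rn) - (D + B) * Rn ≤ Real.log ‖deriv F^[n] (x 0)‖ := by
    rw [hlogn]
    refine le_trans ?_ (Finset.sum_le_sum fun j _ => hlogl (τ j))
    rw [Finset.sum_sub_distrib, Finset.sum_neg_distrib, hind]
    linarith
  set G : ℕ → ℝ := fun i => ∑ j ∈ Finset.range i, (cost (τ j) - if δ₀ < δ (τ j) then D else 0)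
    with hG
  -- With χ = 4ε, decay at rate χ gives 3εn < (C + D + B) Rn, hence (D - C) Rn ≥ 3εn / 2, so `G T ≤
  -- -εn / 2`, which is low enough by the choice of `n`.
  have hGT : G T ≤ -(Q * H) - D := by
    have e1 : G T = ∑ j ∈ Finset.range T, cost (τ j) - D * Rn := by
      simp only [hG]; rw [Finset.sum_sub_distrib, hind]
    have e2 : 3 * ε * n < (C + D + B) * Rn := by
      have : χ = 4 * ε := by rw [hε]; ring
      rw [this] at hbad'
      linarith
    have e3 : (C + D + B) * Rn ≤ 2 * D * Rn :=
      mul_le_mul_of_nonneg_right (by linarith) hRn0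
    have e4 : (4 * C + B) * Rn ≤ D * Rn := mul_le_mul_of_nonneg_right (by linarith) hRn0
    have e5 : χ / 8 * n = ε / 2 * n := by rw [hε]; ring
    rw [e5] at hn
    rw [e1]
    linarith
  -- the near-record resets
  have hrec := exists_record (c := fun j => cost (τ j)) (M := fun j => δ₀ < δ (τ j)) (D := D)
    (H := H) (fun i => hcost0 _) hD0 (by linarith) (T := T) (Q := Q) hGT
  choose! J hJT hJres hJle hJrec using hrec
  set V : ℕ → ℝ := fun i => ∑ j ∈ Finset.range i, Real.log (64 * l (τ j)) with hV
  have hVG : ∀ i j, i ≤ j → j < T → ℓ (τ j) + V j - G j ≤ ℓ (τ i) + V i - G i := by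
    intro i j hij
    induction j, hij using Nat.le_induction with
    | base => exact fun _ => le_rfl
    | succ j hij ih =>
      intro hj
      refine le_trans ?_ (ih (by omega))
      have h1 := hpot (τ j) (hTpos j (by omega)) (by rw [← hτs]; exact hTpos _ hj)
      rw [← hτs] at h1
      have h2 : V (j + 1) = V j + Real.log (64 * l (τ j)) := Finset.sum_range_succ _ _
      have h3 : G (j + 1) = G j + (cost (τ j) - if δ₀ < δ (τ j) then D else 0) :=
        Finset.sum_range_succ _ _
      rw [h2, h3]
      linarith
  have hℓres : ∀ t, δ₀ < δ t → ℓ t = Real.log δ₀ := fun t ht => by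
    simp only [hℓ]; rw [min_eq_right ht.le]
  have hHpos : 0 ≤ H := by linarith
  have hJlt : ∀ a b, a < b → b ≤ Q → J a < J b ∧ V (J b) - V (J a) ≤ -Real.log 16 := by
    intro a b hab hb
    have hab' : (a : ℝ) + 1 ≤ b := by exact_mod_cast hab
    have h3 : (a : ℝ) * H + H ≤ b * H := by nlinarith
    have h1 : G (J b) ≤ -(b * H) := hJle b hb
    have hlt : J a < J b := by
      by_contra! hle
      have h2 : -(a * H) - D < G (J b) := hJrec a (by omega) (J b) hle
      linarith
    refine ⟨hlt, ?_⟩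
    have h4 := hVG (J a) (J b) hlt.le (hJT b hb)
    rw [hℓres _ (hJres b hb), hℓres _ (hJres a (by omega))] at h4
    have h5 : -(a * H) - D < G (J a) := hJrec a (by omega) (J a) le_rfl
    linarith
  -- The disc of radius `s` about a record point is carried forward in time, that is, back up the
  -- path; `V` records the growth of its radius.
  have htrans : ∀ b ≤ Q, ∀ e ≤ J b, ∀ z ∈ ball (x (τ (J b))) s,
      (∀ i < τ (J b - e) - τ (J b), F^[i] z ∈ U) ∧ τ (J b) ≤ τ (J b - e) ∧
      F^[τ (J b - e) - τ (J b)] z ∈ ball (x (τ (J b - e))) (s * Real.exp (V (J b) - V (J b - e))) := by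
    intro b hb e
    induction e with
    | zero => intro _ z hz; simpa using hz
    | succ e ih =>
      intro he z hz
      obtain ⟨h1, h2, h3⟩ := ih (by omega) z hz
      set m := J b - (e + 1) with hm
      have hm1 : J b - e = m + 1 := by omega
      rw [hm1] at h1 h2 h3
      have hmT : m < T := (by omega : m < J b).trans (hJT b hb)
      have hτm := hTpos m hmT
      obtain ⟨-, -, hlp, -, ha, -⟩ := hkl (τ m) hτm
      have hVm : V (m + 1) = V m + Real.log (64 * l (τ m)) := Finset.sum_range_succ _ _
      have hrad : s * Real.exp (V (J b) - V (m + 1)) * (64 * l (τ m)) =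
          s * Real.exp (V (J b) - V m) := by
        rw [hVm, mul_assoc]
        congr 1
        nth_rewrite 2 [← Real.exp_log (by positivity : 0 < 64 * l (τ m))]
        rw [← Real.exp_add]
        congr 1; ring
      -- The radius stays admissible because `s` has the factor exp(-2D): one `D` for the defect of
      -- the near-record, one for the reduced radius at far times.
      have hdom : s * Real.exp (V (J b) - V m) ≤ ρ (τ m) := by
        rw [← Real.log_le_log_iff (by positivity) (hρpos _ hτm), hℓρ _ hτm,
          Real.log_mul hspos.ne' (Real.exp_ne_zero _), Real.log_exp, hlogs]
        have h4 := hVG m (J b) (by omega) (hJT b hb)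
        rw [hℓres _ (hJres b hb)] at h4
        have h5 : -(b * H) - D < G m := hJrec b hb m (by omega)
        have h6 : G (J b) ≤ -(b * H) := hJle b hb
        split_ifs <;> linarith
      obtain ⟨h7, h8⟩ := ha (s * Real.exp (V (J b) - V (m + 1))) (by rw [hrad]; exact hdom)
      rw [← hτs, hrad] at h8
      rw [← hτs] at h7
      have hk' := hτk m
      have hsplit : τ m - τ (J b) = k (τ m) + (τ (m + 1) - τ (J b)) := by omega
      refine ⟨fun i hi => ?_, by omega, ?_⟩
      · rcases lt_or_ge i (τ (m + 1) - τ (J b)) with hi1 | hi1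
        · exact h1 i hi1
        · have := h7 _ h3 (i - (τ (m + 1) - τ (J b))) (by omega)
          rwa [← Function.iterate_add_apply, Nat.sub_add_cancel hi1] at this
      · rw [hsplit, Function.iterate_add_apply]
        exact h8 h3
  -- pigeonhole
  have hcov : ∀ t, ∃ y ∈ hYfin.toFinset, x t ∈ ball y (s / 16) := by
    intro t
    obtain ⟨y, hy, hty⟩ := mem_iUnion₂.1 (hY (mem_range_self t))
    exact ⟨y, hYfin.mem_toFinset.2 hy, hty⟩
  choose y hyY hy using hcov
  obtain ⟨a, ha, b, hb, hab, hyab⟩ := Finset.exists_ne_map_eq_of_card_lt_of_maps_to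
    (s := Finset.range (Q + 1)) (t := hYfin.toFinset) (f := fun b => y (τ (J b)))
    (by rw [Finset.card_range]; omega) (fun b _ => hyY _)
  wlog hlt : a < b generalizing a b
  · exact this b hb a ha hab.symm hyab.symm (by omega)
  have hbQ : b ≤ Q := by have := Finset.mem_range.1 hb; omega
  obtain ⟨hJab, hVab⟩ := hJlt a b hlt hbQ
  have hae : J b - (J b - J a) = J a := by omega
  have hdist : dist (x (τ (J a))) (x (τ (J b))) < s / 8 := by
    have h1 := hy (τ (J a))
    have h2 := hy (τ (J b))
    rw [hyab, mem_ball] at h1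
    rw [mem_ball] at h2
    clear_value s
    linarith only [h1, h2, dist_triangle_right (x (τ (J a))) (x (τ (J b))) (y (τ (J b)))]
  have hexp : s * Real.exp (V (J b) - V (J a)) ≤ s / 16 := by
    have : Real.exp (V (J b) - V (J a)) ≤ 1 / 16 := by
      calc Real.exp (V (J b) - V (J a)) ≤ Real.exp (-Real.log 16) := Real.exp_le_exp.2 hVab
        _ = 1 / 16 := by rw [Real.exp_neg, Real.exp_log (by norm_num)]; norm_num
    calc s * Real.exp (V (J b) - V (J a)) ≤ s * (1 / 16) := by gcongr
      _ = s / 16 := by ring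
  have hmono : τ (J b) < τ (J a) := by
    have hanti : Antitone τ := antitone_nat_of_succ_le fun i => by rw [hτs]; exact Nat.sub_le _ _
    have h1 := hanti (show J a + 1 ≤ J b from hJab)
    have h2 := (hkl _ (hTpos (J a) (hJT a (by omega)))).1
    have h3 := hτk (J a)
    omega
  -- The image disc has radius at most s/16 and its centre is within s/8 of the original one, so it
  -- lies in the disc of radius s/4.
  refine hnc ⟨τ (J b), τ (J a) - τ (J b), s, by omega, hspos, fun z hz => ?_, fun z hz => ?_⟩
  · have := (htrans b hbQ (J b - J a) (by omega) z hz).1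
    rwa [hae] at this
  · have := (htrans b hbQ (J b - J a) (by omega) z hz).2.2
    rw [hae, mem_ball] at this
    rw [mem_ball]
    clear_value s
    linarith only [this, hexp, hdist, hspos, dist_triangle (F^[τ (J a) - τ (J b)] z) (x (τ (J a))) (x (τ (J b)))]

end PlanarOrbit

/-! ### From contraction to attracting cycles -/

/-- An attracting cycle of `F` in `U`, through `p`, that attracts the orbit `x`. -/
def CapturedBy (F : ℂ → ℂ) (U : Set ℂ) (x : ℕ → ℂ) (p : ℂ) : Prop :=
  ∃ t m : ℕ, 0 < m ∧ F^[m] p = p ∧ (∀ i < m, F^[i] p ∈ U) ∧ ‖deriv F^[m] p‖ < 1 ∧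
    Tendsto (fun j : ℕ => x (t + m * j)) atTop (𝓝 p)

namespace PlanarOrbit

variable {F : ℂ → ℂ} {U : Set ℂ} {x : ℕ → ℂ} {ρ₀ : ℝ}

/-- Cauchy's estimate bounds the derivative by 2/3 on the closed disc of radius s/4, and Banach's
fixed point theorem gives the cycle together with convergence of the orbit of the centre. -/
lemma exists_capturedBy_of_contracts (h : PlanarOrbit F U x ρ₀) (hc : Contracts F U x) :
    ∃ p, CapturedBy F U x p := by
  obtain ⟨t, m, s, hm, hs, hU, hmap⟩ := hc
  have hd : DifferentiableOn ℂ F^[m] (ball (x t) s) := fun z hz =>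
    (differentiableAt_iterate h.isOpen h.holo m (hU z hz)).differentiableWithinAt
  set K := closedBall (x t) (s / 4) with hK
  have hKs : K ⊆ ball (x t) s := closedBall_subset_ball (by linarith)
  have hder : ∀ z ∈ K, ‖deriv F^[m] z‖ ≤ 2 / 3 := by
    intro z hz
    have hsub : ball z (3 * s / 4) ⊆ ball (x t) s :=
      ball_subset_ball' (by rw [hK, mem_closedBall] at hz; linarith)
    have h1 := Complex.norm_deriv_le_div_of_mapsTo_ball (R₂ := s / 2) (hd.mono hsub)
      (fun w hw => by
        have e1 := hmap (hsub hw)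
        have e2 := hmap (hKs hz)
        rw [mem_ball] at e1 e2
        rw [mem_closedBall]
        linarith [dist_triangle_right (F^[m] w) (F^[m] z) (x t)]) (by linarith)
    refine h1.trans (le_of_eq ?_)
    field_simp; norm_num
  have hKK : MapsTo F^[m] K K := fun z hz => ball_subset_closedBall (hmap (hKs hz))
  have hlip : LipschitzOnWith (2 / 3) F^[m] K :=
    (convex_closedBall _ _).lipschitzOnWith_of_nnnorm_deriv_le
      (fun z hz => hd.differentiableAt (isOpen_ball.mem_nhds (hKs hz)))
      (fun z hz => by
        rw [← NNReal.coe_le_coe]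
        simpa using hder z hz)
  have hcontr : ContractingWith (2 / 3) (hKK.restrict F^[m] K K) :=
    ⟨by rw [← NNReal.coe_lt_coe]; push_cast; norm_num, hlip.mapsToRestrict hKK⟩
  obtain ⟨p, hpK, hfix, htend, -⟩ := hcontr.exists_fixedPoint' isClosed_closedBall.isComplete hKK
    (mem_closedBall_self (by linarith) : x t ∈ K) (edist_ne_top _ _)
  refine ⟨p, t, m, hm, hfix, hU p (hKs hpK), (hder p hpK).trans_lt (by norm_num), ?_⟩
  refine htend.congr fun j => ?_
  rw [← Function.iterate_mul, h.iterate]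

/-- If x 0 is periodic, its multiplier decides: below 1 the cycle itself is attracting; otherwise
the derivatives over full periods are at least 1 and the remainders are bounded below. -/
lemma periodic_dichotomy (h : PlanarOrbit F U x ρ₀) {n : ℕ} (hn : 1 ≤ n) (hx : x n = x 0) :
    (∃ p, CapturedBy F U x p) ∨
      ∀ χ > 0, ∀ᶠ n : ℕ in atTop, Real.exp (-χ * n) ≤ ‖deriv F^[n] (x 0)‖ := by
  have hper : ∀ j, x (n * j) = x 0 := by
    intro j
    induction j with
    | zero => rfl
    | succ j ih => rw [mul_add, mul_one, add_comm, ← h.iterate, hx, h.iterate, zero_add] at *; exact ih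
  rcases lt_or_ge ‖deriv F^[n] (x 0)‖ 1 with hlt | hge
  · left
    refine ⟨x 0, 0, n, hn, by rw [h.iterate, zero_add, hx],
      fun i _ => by rw [h.iterate]; exact h.mem _, hlt, ?_⟩
    simp only [zero_add, hper]
    exact tendsto_const_nhds
  · right
    intro χ hχ
    have hpow : ∀ j, 1 ≤ ‖deriv F^[n * j] (x 0)‖ := by
      intro j
      induction j with
      | zero => simp
      | succ j ih =>
        rw [mul_add, mul_one, add_comm, h.norm_deriv_add, hper]
        nlinarith
    have hposi : ∀ i, i ≤ n → 0 < ‖deriv F^[i] (x 0)‖ := by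
      intro i hi
      have h1 := h.norm_deriv_add (n - i) i
      rw [Nat.sub_add_cancel hi] at h1
      refine (norm_nonneg _).lt_of_ne' fun h0 => ?_
      rw [h0, mul_zero] at h1
      linarith
    obtain ⟨c, hc, hcle⟩ : ∃ c > 0, ∀ i < n, c ≤ ‖deriv F^[i] (x 0)‖ := by
      obtain ⟨i₀, hi₀, hmin⟩ := (Finset.range n).exists_min_image (fun i => ‖deriv F^[i] (x 0)‖)
        ⟨0, Finset.mem_range.2 hn⟩
      exact ⟨_, hposi i₀ (Finset.mem_range.1 hi₀).le, fun i hi => hmin i (Finset.mem_range.2 hi)⟩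
    have hsmall : ∀ᶠ N : ℕ in atTop, Real.exp (-χ * N) < c := by
      have h1 : Tendsto (fun N : ℕ => -χ * (N : ℝ)) atTop atBot :=
        tendsto_natCast_atTop_atTop.const_mul_atTop_of_neg (by linarith)
      exact (Real.tendsto_exp_atBot.comp h1).eventually_lt_const hc
    filter_upwards [hsmall] with N hN
    refine hN.le.trans ?_
    have h1 := h.norm_deriv_add (N % n) (n * (N / n))
    rw [Nat.mod_add_div, hper] at h1
    rw [h1]
    nlinarith [hcle (N % n) (Nat.mod_lt _ hn), hpow (N / n)]

/-- A bounded orbit along which inverse branches extend is attracted by an attracting cycle, or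
its derivatives do not decay exponentially. -/
theorem dichotomy (h : PlanarOrbit F U x ρ₀) :
    (∃ p, CapturedBy F U x p) ∨
      ∀ χ > 0, ∀ᶠ n : ℕ in atTop, Real.exp (-χ * n) ≤ ‖deriv F^[n] (x 0)‖ := by
  by_cases hne : ∀ n, 1 ≤ n → x n ≠ x 0
  · by_cases hc : Contracts F U x
    · exact Or.inl (h.exists_capturedBy_of_contracts hc)
    · exact Or.inr fun χ hχ => h.eventually_exp_le hne hc hχ
  · push Not at hne
    obtain ⟨n, hn, hx⟩ := hne
    exact h.periodic_dichotomy hn hx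

end PlanarOrbit

/-! ### Holomorphic maps of the sphere in homogeneous coordinates -/

namespace RiemannSphere

open Classical in
/-- The point of the sphere with the given homogeneous coordinates. -/
def proj (v : ℂ × ℂ) : RiemannSphere :=
  if v.2 = 0 then OnePoint.infty else ((v.1 / v.2 : ℂ) : OnePoint ℂ)

/-- Homogeneous coordinates of a point. -/
def rep : RiemannSphere → ℂ × ℂ
  | some z => (z, 1)
  | none => (1, 0)

/-- Homogeneous coordinates of the point with a given coordinate around `b`. -/
def lin : RiemannSphere → ℂ → ℂ × ℂ
  | some _, u => (u, 1)
  | none, u => (1, u)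

/-- The numerator of the coordinate around `b`. -/
def num : RiemannSphere → ℂ × ℂ → ℂ
  | some _, v => v.1
  | none, v => v.2

/-- The denominator of the coordinate around `b`. -/
def den : RiemannSphere → ℂ × ℂ → ℂ
  | some _, v => v.2
  | none, v => v.1

lemma proj_rep (z : RiemannSphere) : proj (rep z) = z := by
  cases z <;> simp [proj, rep] <;> rfl

lemma rep_ne_zero (z : RiemannSphere) : rep z ≠ 0 := by
  cases z <;> simp [rep]

lemma lin_ne_zero (b : RiemannSphere) (u : ℂ) : lin b u ≠ 0 := by
  cases b <;> simp [lin]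

lemma proj_smul {c : ℂ} (hc : c ≠ 0) (v : ℂ × ℂ) : proj (c • v) = proj v := by
  simp only [proj, Prod.smul_snd, Prod.smul_fst, smul_eq_mul, mul_eq_zero, hc, false_or]
  rw [mul_div_mul_left _ _ hc]

lemma exists_smul_rep {v : ℂ × ℂ} (hv : v ≠ 0) : ∃ c : ℂ, c ≠ 0 ∧ v = c • rep (proj v) := by
  obtain ⟨a, b⟩ := v
  by_cases hb : b = 0
  · subst hb
    have ha : a ≠ 0 := fun h => hv (by simp [h])
    refine ⟨a, ha, ?_⟩
    simp only [proj, if_true]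
    change (a, (0 : ℂ)) = a • ((1 : ℂ), (0 : ℂ))
    simp
  · refine ⟨b, hb, ?_⟩
    simp only [proj, if_neg hb]
    change (a, b) = b • (a / b, (1 : ℂ))
    simp [mul_div_cancel₀ _ hb]

lemma param_eq_proj (b : RiemannSphere) (u : ℂ) : param b u = proj (lin b u) := by
  cases b
  · simp [param, proj, lin]
  · simp [param, proj, lin]

lemma coord_proj (b : RiemannSphere) (v : ℂ × ℂ) : coord b (proj v) = num b v / den b v := by
  obtain ⟨x, y⟩ := v
  by_cases hy : y = 0
  · subst hy
    simp only [proj, if_true]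
    cases b
    · change (0 : ℂ) = _; simp [num]
    · change (0 : ℂ) = _; simp [den]
  · simp only [proj, if_neg hy]
    cases b
    · change (x / y)⁻¹ = _; simp [num, den]
    · rfl

/-- The domain of the coordinate around `b`. -/
def chartDomain : RiemannSphere → Set RiemannSphere
  | some _ => {OnePoint.infty}ᶜ
  | none => {((0 : ℂ) : OnePoint ℂ)}ᶜ

lemma isOpen_chartDomain (b : RiemannSphere) : IsOpen (chartDomain b) := by
  cases b <;> exact isOpen_compl_singleton

lemma mem_chartDomain_self (b : RiemannSphere) : b ∈ chartDomain b := by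
  cases b
  · exact OnePoint.infty_ne_coe _
  · exact OnePoint.coe_ne_infty _

lemma proj_mem_chartDomain {b : RiemannSphere} {v : ℂ × ℂ} (hv : v ≠ 0) :
    proj v ∈ chartDomain b ↔ den b v ≠ 0 := by
  obtain ⟨x, y⟩ := v
  cases b
  · change ¬ (proj (x, y) = ((0 : ℂ) : OnePoint ℂ)) ↔ x ≠ 0
    rw [proj]
    by_cases hy : y = 0
    · have hx : x ≠ 0 := fun h => hv (by simp [h, hy])
      simp [hy, hx]
    · simp [hy]
  · change ¬ (proj (x, y) = OnePoint.infty) ↔ y ≠ 0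
    rw [proj]
    by_cases hy : y = 0 <;> simp [hy]

@[simp] lemma coord_param (b : RiemannSphere) (u : ℂ) : coord b (param b u) = u := by
  rw [param_eq_proj, coord_proj]
  cases b <;> simp [num, den, lin]

lemma param_coord {b z : RiemannSphere} (hz : z ∈ chartDomain b) : param b (coord b z) = z := by
  have hz' := hz
  rw [← proj_rep z] at hz' ⊢
  rw [proj_mem_chartDomain (rep_ne_zero z)] at hz'
  rw [coord_proj, param_eq_proj, ← proj_smul hz']
  congr 1
  cases b <;> simp only [num, den, lin] at * <;> ext <;> simp <;> field_simp

lemma param_coord_self (b : RiemannSphere) : param b (coord b b) = b :=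
  param_coord (mem_chartDomain_self b)

/-- Holomorphic self-maps of the sphere, presented by a holomorphic map in homogeneous
coordinates. -/
def HasLift (S : RiemannSphere → RiemannSphere) : Prop :=
  ∃ Φ : ℂ × ℂ → ℂ × ℂ, Differentiable ℂ Φ ∧ ∀ v ≠ 0, Φ v ≠ 0 ∧ S (proj v) = proj (Φ v)

lemma hasLift_id : HasLift id := ⟨id, differentiable_id, fun _ hv => ⟨hv, rfl⟩⟩

lemma HasLift.comp {S S' : RiemannSphere → RiemannSphere} (h : HasLift S) (h' : HasLift S') :
    HasLift (S ∘ S') := by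
  obtain ⟨Φ, hΦ, hS⟩ := h
  obtain ⟨Φ', hΦ', hS'⟩ := h'
  refine ⟨Φ ∘ Φ', hΦ.comp hΦ', fun v hv => ⟨(hS _ (hS' v hv).1).1, ?_⟩⟩
  rw [Function.comp, (hS' v hv).2, (hS _ (hS' v hv).1).2]; rfl

lemma HasLift.iterate {S : RiemannSphere → RiemannSphere} (h : HasLift S) (n : ℕ) :
    HasLift S^[n] := by
  induction n with
  | zero => exact hasLift_id
  | succ n ih => rw [Function.iterate_succ']; exact h.comp ih

lemma hasLift_of_homogeneous {S : RiemannSphere → RiemannSphere} {Φ : ℂ × ℂ → ℂ × ℂ} {d : ℕ}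
    (hΦ : Differentiable ℂ Φ) (h0 : ∀ v ≠ 0, Φ v ≠ 0)
    (hom : ∀ (c : ℂ) v, Φ (c • v) = c ^ d • Φ v) (hS : ∀ z, S z = proj (Φ (rep z))) :
    HasLift S := by
  refine ⟨Φ, hΦ, fun v hv => ⟨h0 v hv, ?_⟩⟩
  obtain ⟨c, hc, hvc⟩ := exists_smul_rep hv
  rw [hS]
  conv_rhs => rw [hvc, hom, proj_smul (pow_ne_zero _ hc)]

lemma continuousAt_proj {v : ℂ × ℂ} (hv : v ≠ 0) : ContinuousAt proj v := by
  by_cases h2 : v.2 = 0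
  · have h1 : v.1 ≠ 0 := fun h => hv (Prod.ext h h2)
    have hp : proj v = OnePoint.infty := by simp [proj, h2]
    rw [ContinuousAt, hp, Tendsto, OnePoint.le_nhds_infty]
    intro s _ hs
    obtain ⟨K, hK⟩ := isBounded_iff_forall_norm_le.1 hs.isBounded
    have hq : Tendsto (fun w : ℂ × ℂ => w.2 / w.1) (𝓝 v) (𝓝 0) := by
      have : ContinuousAt (fun w : ℂ × ℂ => w.2 / w.1) v :=
        continuousAt_snd.div continuousAt_fst h1
      simpa [ContinuousAt, h2] using this
    have hsm : ∀ᶠ w : ℂ × ℂ in 𝓝 v, ‖w.2 / w.1‖ * (|K| + 1) < 1 := by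
      have : Tendsto (fun w : ℂ × ℂ => ‖w.2 / w.1‖ * (|K| + 1)) (𝓝 v) (𝓝 0) := by
        simpa using (hq.norm).mul_const (|K| + 1)
      exact this.eventually_lt_const one_pos
    have hne : ∀ᶠ w : ℂ × ℂ in 𝓝 v, w.1 ≠ 0 := continuousAt_fst.eventually_ne h1
    rw [Filter.mem_map]
    filter_upwards [hsm, hne] with w hw hw1
    by_cases hw2 : w.2 = 0
    · right; simp [proj, hw2]
    · left
      refine ⟨w.1 / w.2, fun hmem => ?_, by simp [proj, hw2]⟩
      have hk := hK _ hmem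
      have e : ‖w.2 / w.1‖ * ‖w.1 / w.2‖ = 1 := by
        rw [← norm_mul]; field_simp; simp
      nlinarith [norm_nonneg (w.2 / w.1), le_abs_self K]
  · have : ContinuousAt (fun w : ℂ × ℂ => ((w.1 / w.2 : ℂ) : OnePoint ℂ)) v :=
      OnePoint.continuous_coe.continuousAt.comp (continuousAt_fst.div continuousAt_snd h2)
    refine this.congr ?_
    filter_upwards [continuousAt_snd.eventually_ne h2] with w hw
    simp [proj, hw]

lemma differentiable_lin (b : RiemannSphere) : Differentiable ℂ (lin b) := by
  cases b
  · change Differentiable ℂ fun u : ℂ => ((1 : ℂ), u)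
    fun_prop
  · change Differentiable ℂ fun u : ℂ => (u, (1 : ℂ))
    fun_prop

lemma continuous_param (b : RiemannSphere) : Continuous (param b) := by
  have : param b = fun u => proj (lin b u) := funext (param_eq_proj b)
  rw [this, continuous_iff_continuousAt]
  intro u
  exact (continuousAt_proj (lin_ne_zero b u)).comp (f := lin b)
    (differentiable_lin b).continuous.continuousAt

lemma HasLift.continuous {S : RiemannSphere → RiemannSphere} (h : HasLift S) : Continuous S := by
  obtain ⟨Φ, hΦ, hS⟩ := h
  have hpar : ∀ b, Continuous fun u => S (param b u) := by
    intro b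
    have : (fun u => S (param b u)) = fun u => proj (Φ (lin b u)) := by
      funext u; rw [param_eq_proj, (hS _ (lin_ne_zero b u)).2]
    rw [this, continuous_iff_continuousAt]
    intro u
    exact (continuousAt_proj (hS _ (lin_ne_zero b u)).1).comp (f := fun u => Φ (lin b u))
      (hΦ.continuous.comp (differentiable_lin b).continuous).continuousAt
  rw [continuous_iff_continuousAt]
  intro z
  induction z using OnePoint.rec with
  | infty =>
    rw [OnePoint.continuousAt_infty', coclosedCompact_eq_cocompact, ← cobounded_eq_cocompact]
    have h1 := ((hpar OnePoint.infty).tendsto 0).comp (tendsto_inv₀_cobounded (α := ℂ))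
    have e0 : param OnePoint.infty 0 = OnePoint.infty := by
      change (if (0 : ℂ) = 0 then _ else _) = _; simp
    rw [e0] at h1
    refine h1.congr' ?_
    have : ∀ᶠ u : ℂ in Bornology.cobounded ℂ, u ≠ 0 := Bornology.eventually_ne_cobounded 0
    filter_upwards [this] with u hu
    simp only [Function.comp]
    congr 1
    change (if u⁻¹ = 0 then _ else _) = _
    simp [hu]
  | coe z =>
    rw [OnePoint.continuousAt_coe]
    exact (hpar ((0 : ℂ) : OnePoint ℂ)).continuousAt

lemma HasLift.differentiableAt {S : RiemannSphere → RiemannSphere} (h : HasLift S)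
    {b c : RiemannSphere} {u : ℂ} (hu : S (param b u) ∈ chartDomain c) :
    DifferentiableAt ℂ (fun u => coord c (S (param b u))) u := by
  obtain ⟨Φ, hΦ, hS⟩ := h
  have e : (fun u => coord c (S (param b u))) =
      fun u => num c (Φ (lin b u)) / den c (Φ (lin b u)) := by
    funext u; rw [param_eq_proj, (hS _ (lin_ne_zero b u)).2, coord_proj]
  rw [param_eq_proj, (hS _ (lin_ne_zero b u)).2,
    proj_mem_chartDomain (hS _ (lin_ne_zero b u)).1] at hu
  rw [e]
  have hl : DifferentiableAt ℂ (fun u => Φ (lin b u)) u := (hΦ _).comp u (differentiable_lin b u)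
  refine DifferentiableAt.div ?_ ?_ hu
  · cases c
    exacts [hl.snd, hl.fst]
  · cases c
    exacts [hl.fst, hl.snd]

lemma HasLift.isOpen_preimage {S : RiemannSphere → RiemannSphere} (h : HasLift S)
    (b c : RiemannSphere) : IsOpen {u | S (param b u) ∈ chartDomain c} :=
  (isOpen_chartDomain c).preimage (h.continuous.comp (continuous_param b))

lemma HasLift.differentiableOn {S : RiemannSphere → RiemannSphere} (h : HasLift S)
    (b c : RiemannSphere) : DifferentiableOn ℂ (fun u => coord c (S (param b u)))
      {u | S (param b u) ∈ chartDomain c} :=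
  fun _ hu => (h.differentiableAt hu).differentiableWithinAt

lemma HasLift.hasStrictDerivAt {S : RiemannSphere → RiemannSphere} (h : HasLift S)
    (b : RiemannSphere) : HasStrictDerivAt (fun u => coord (S b) (S (param b u)))
      (chartDeriv S b) (coord b b) := by
  refine ((h.differentiableOn b (S b)).analyticAt
    ((h.isOpen_preimage b (S b)).mem_nhds ?_)).hasStrictDerivAt
  rw [mem_ofPred_eq, param_coord_self]
  exact mem_chartDomain_self _

lemma HasLift.chartDeriv_comp {S S' : RiemannSphere → RiemannSphere} (h : HasLift S)
    (h' : HasLift S') (b : RiemannSphere) :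
    chartDeriv (S ∘ S') b = chartDeriv S (S' b) * chartDeriv S' b := by
  have h1 := (h'.hasStrictDerivAt b).hasDerivAt
  have h2 := (h.hasStrictDerivAt (S' b)).hasDerivAt
  have h3 := h2.comp_of_eq (coord b b) h1 (by rw [param_coord_self])
  refine (h3.congr_of_eventuallyEq ?_).deriv
  have hmem : {u | S' (param b u) ∈ chartDomain (S' b)} ∈ 𝓝 (coord b b) :=
    (h'.isOpen_preimage b (S' b)).mem_nhds (by
      rw [mem_ofPred_eq, param_coord_self]; exact mem_chartDomain_self _)
  filter_upwards [hmem] with u hu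
  simp only [Function.comp]
  rw [param_coord hu]

lemma chartDeriv_id (b : RiemannSphere) : chartDeriv id b = 1 := by
  have : (fun u : ℂ => coord (id b) (id (param b u))) = id := by funext u; simp
  rw [chartDeriv, this, deriv_id]

lemma chartDeriv_mul_of_leftInverse {S S' : RiemannSphere → RiemannSphere} (h : HasLift S)
    (h' : HasLift S') (hi : Function.LeftInverse S S') (b : RiemannSphere) :
    chartDeriv S (S' b) * chartDeriv S' b = 1 := by
  rw [← h.chartDeriv_comp h', hi.comp_eq_id, chartDeriv_id]

lemma density_pos (b : RiemannSphere) : 0 < density b := by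
  unfold density; positivity

/-! ### Möbius maps sending `∞` to a given point -/

/-- A linear map sending homogeneous coordinates of `∞` to those of `q`. -/
def mobLift : RiemannSphere → ℂ × ℂ → ℂ × ℂ
  | some q, v => (q * v.1 + v.2, v.1)
  | none, v => v

/-- The inverse of `mobLift q`. -/
def mobInvLift : RiemannSphere → ℂ × ℂ → ℂ × ℂ
  | some q, v => (v.2, v.1 - q * v.2)
  | none, v => v

/-- A Möbius map sending `∞` to `q`. -/
def mob (q z : RiemannSphere) : RiemannSphere := proj (mobLift q (rep z))

/-- The inverse of `mob q`. -/
def mobInv (q z : RiemannSphere) : RiemannSphere := proj (mobInvLift q (rep z))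

lemma mobLift_mobInvLift (q : RiemannSphere) (v : ℂ × ℂ) : mobLift q (mobInvLift q v) = v := by
  cases q <;> simp [mobLift, mobInvLift]

lemma mobInvLift_mobLift (q : RiemannSphere) (v : ℂ × ℂ) : mobInvLift q (mobLift q v) = v := by
  cases q <;> simp [mobLift, mobInvLift]

lemma mobLift_zero (q : RiemannSphere) : mobLift q 0 = 0 := by
  cases q <;> simp [mobLift]

lemma mobInvLift_zero (q : RiemannSphere) : mobInvLift q 0 = 0 := by
  cases q <;> simp [mobInvLift]

lemma mobLift_ne_zero {q : RiemannSphere} {v : ℂ × ℂ} (hv : v ≠ 0) : mobLift q v ≠ 0 := fun h =>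
  hv (by rw [← mobInvLift_mobLift q v, h, mobInvLift_zero])

lemma mobInvLift_ne_zero {q : RiemannSphere} {v : ℂ × ℂ} (hv : v ≠ 0) : mobInvLift q v ≠ 0 :=
  fun h => hv (by rw [← mobLift_mobInvLift q v, h, mobLift_zero])

lemma mobLift_smul (q : RiemannSphere) (c : ℂ) (v : ℂ × ℂ) :
    mobLift q (c • v) = c ^ 1 • mobLift q v := by
  cases q
  · simp [mobLift]
  · ext <;> simp [mobLift]; ring

lemma mobInvLift_smul (q : RiemannSphere) (c : ℂ) (v : ℂ × ℂ) :
    mobInvLift q (c • v) = c ^ 1 • mobInvLift q v := by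
  cases q
  · simp [mobInvLift]
  · ext <;> simp [mobInvLift]; ring

lemma hasLift_mob (q : RiemannSphere) : HasLift (mob q) := by
  refine hasLift_of_homogeneous (Φ := mobLift q) ?_ (fun v hv => mobLift_ne_zero hv)
    (mobLift_smul q) (fun z => rfl)
  cases q
  · exact differentiable_id
  · rename_i q
    change Differentiable ℂ fun v : ℂ × ℂ => (q * v.1 + v.2, v.1)
    fun_prop

lemma hasLift_mobInv (q : RiemannSphere) : HasLift (mobInv q) := by
  refine hasLift_of_homogeneous (Φ := mobInvLift q) ?_ (fun v hv => mobInvLift_ne_zero hv)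
    (mobInvLift_smul q) (fun z => rfl)
  cases q
  · exact differentiable_id
  · rename_i q
    change Differentiable ℂ fun v : ℂ × ℂ => (v.2, v.1 - q * v.2)
    fun_prop

lemma mobInv_mob (q : RiemannSphere) : Function.LeftInverse (mobInv q) (mob q) := by
  intro z
  obtain ⟨c, hc, hv⟩ := exists_smul_rep (mobLift_ne_zero (q := q) (rep_ne_zero z))
  have h1 := congrArg (mobInvLift q) hv
  rw [mobInvLift_mobLift, mobInvLift_smul, pow_one] at h1
  rw [mobInv, mob, ← proj_smul hc, ← h1, proj_rep]

lemma mob_mobInv (q : RiemannSphere) : Function.LeftInverse (mob q) (mobInv q) := by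
  intro z
  obtain ⟨c, hc, hv⟩ := exists_smul_rep (mobInvLift_ne_zero (q := q) (rep_ne_zero z))
  have h1 := congrArg (mobLift q) hv
  rw [mobLift_mobInvLift, mobLift_smul, pow_one] at h1
  rw [mob, mobInv, ← proj_smul hc, ← h1, proj_rep]

lemma mob_infty (q : RiemannSphere) : mob q OnePoint.infty = q := by
  change proj (mobLift q (1, 0)) = q
  cases q
  · change proj (1, 0) = _; simp [proj]; rfl
  · simp [mobLift, proj]; rfl

/-- `mob q` as a homeomorphism. -/
def mobHomeomorph (q : RiemannSphere) : RiemannSphere ≃ₜ RiemannSphere where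
  toFun := mob q
  invFun := mobInv q
  left_inv := mobInv_mob q
  right_inv := mob_mobInv q
  continuous_toFun := (hasLift_mob q).continuous
  continuous_invFun := (hasLift_mobInv q).continuous

lemma isOpenEmbedding_param (b : RiemannSphere) : IsOpenEmbedding (param b) := by
  cases b
  · have : param OnePoint.infty = mobHomeomorph ((0 : ℂ) : OnePoint ℂ) ∘ ((↑) : ℂ → OnePoint ℂ) := by
      funext u
      rw [param_eq_proj]
      change proj (1, u) = proj (0 * u + 1, u)
      simp
    change IsOpenEmbedding (param OnePoint.infty)
    rw [this]
    exact (mobHomeomorph _).isOpenEmbedding.comp OnePoint.isOpenEmbedding_coe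
  · exact OnePoint.isOpenEmbedding_coe

end RiemannSphere

/-! ### Coverings outside the critical values and lifts of branches -/

namespace RiemannSphere

variable {S : RiemannSphere → RiemannSphere}

lemma HasLift.exists_openPartialHomeomorph (h : HasLift S) {b : RiemannSphere}
    (hb : chartDeriv S b ≠ 0) :
    ∃ e : OpenPartialHomeomorph RiemannSphere RiemannSphere, b ∈ e.source ∧ EqOn S e e.source := by
  have hG := (h.hasStrictDerivAt b).hasStrictFDerivAt_equiv hb
  set e₁ := (isOpenEmbedding_param b).toOpenPartialHomeomorph
  set e₂ := hG.toOpenPartialHomeomorph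
  set e₃ := (isOpenEmbedding_param (S b)).toOpenPartialHomeomorph
  have hb₁ : e₁ (coord b b) = b := param_coord_self b
  have hb₁' : e₁.symm b = coord b b := by
    conv_lhs => rw [← hb₁]
    exact e₁.left_inv (mem_univ _)
  refine ⟨((e₁.symm.trans e₂).trans e₃).restrOpen (S ⁻¹' chartDomain (S b))
    ((isOpen_chartDomain _).preimage h.continuous), ⟨⟨⟨?_, ?_⟩, mem_univ _⟩, ?_⟩, ?_⟩
  · exact ⟨coord b b, mem_univ _, param_coord_self b⟩
  · change e₁.symm b ∈ e₂.source
    rw [hb₁']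
    exact hG.mem_toOpenPartialHomeomorph_source
  · exact mem_chartDomain_self _
  · rintro w ⟨⟨⟨hw, -⟩, -⟩, hw'⟩
    have e : e₁ (e₁.symm w) = w := e₁.right_inv hw
    change S w = param (S b) (coord (S b) (S (e₁ (e₁.symm w))))
    rw [e, param_coord hw']

/-- The sphere is compact Hausdorff, so a continuous self-map that is a local homeomorphism over a
set covers it. -/
lemma HasLift.isCoveringMapOn (h : HasLift S) : IsCoveringMapOn S (criticalValues S)ᶜ :=
  .of_isLocalHomeomorphOn h.continuous <| .mk _ _ fun b hb =>
    h.exists_openPartialHomeomorph fun h0 => hb ⟨b, h0, rfl⟩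

lemma HasLift.existsUnique_lift (h : HasLift S) {V : Set ℂ} (hV : IsOpen V) (hVc : Convex ℝ V)
    {f : ℂ → RiemannSphere} (hf : ContinuousOn f V) (hcv : ∀ z ∈ V, f z ∉ criticalValues S)
    {a : ℂ} (ha : a ∈ V) {e : RiemannSphere} (he : S e = f a) :
    ∃! Γ : C(V, RiemannSphere), Γ ⟨a, ha⟩ = e ∧ S ∘ Γ = fun z : V => f z := by
  have : ContractibleSpace V := hVc.contractibleSpace ⟨a, ha⟩
  have : LocallyPathConnectedSpace V := hV.locallyPathConnectedSpace
  exact h.isCoveringMapOn.existsUnique_continuousMap_lifts ⟨_, hf.domRestrict⟩ (a₀ := ⟨a, ha⟩) he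
    fun z => hcv z z.2

lemma HasLift.exists_lift (h : HasLift S) {V : Set ℂ} (hV : IsOpen V) (hVc : Convex ℝ V)
    {f : ℂ → RiemannSphere} (hf : ContinuousOn f V) (hcv : ∀ z ∈ V, f z ∉ criticalValues S)
    {a : ℂ} (ha : a ∈ V) {e : RiemannSphere} (he : S e = f a) :
    ∃ Γ : ℂ → RiemannSphere, ContinuousOn Γ V ∧ Γ a = e ∧ ∀ z ∈ V, S (Γ z) = f z := by
  classical
  obtain ⟨Γ, ⟨h1, h2⟩, -⟩ := h.existsUnique_lift hV hVc hf hcv ha he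
  refine ⟨fun z => if hz : z ∈ V then Γ ⟨z, hz⟩ else OnePoint.infty, ?_, by simp [ha, h1], ?_⟩
  · rw [continuousOn_iff_continuous_domRestrict]
    refine Γ.continuous.congr fun z => ?_
    simp
  · intro z hz
    simpa [hz] using congrFun h2 ⟨z, hz⟩

/-- The affine coordinate of a point of the sphere. -/
abbrev toComplex : RiemannSphere → ℂ := coord ((0 : ℂ) : OnePoint ℂ)

lemma toComplex_coe (u : ℂ) : toComplex (u : OnePoint ℂ) = u := rfl

lemma coe_toComplex {z : RiemannSphere} (hz : z ≠ OnePoint.infty) :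
    ((toComplex z : ℂ) : OnePoint ℂ) = z :=
  param_coord (b := ((0 : ℂ) : OnePoint ℂ)) hz

lemma coord_coe (u : ℂ) : coord (u : OnePoint ℂ) = toComplex := by
  funext z
  cases z <;> rfl

lemma chartDeriv_coe {u : ℂ} (hu : S u ≠ OnePoint.infty) :
    chartDeriv S u = deriv (fun w : ℂ => toComplex (S w)) u := by
  rw [chartDeriv, ← coe_toComplex hu, coord_coe, coord_coe]
  rfl

lemma HasLift.hasStrictDerivAt_coe (h : HasLift S) {u : ℂ} (hu : S u ≠ OnePoint.infty) :
    HasStrictDerivAt (fun w : ℂ => toComplex (S w)) (chartDeriv S u) u := by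
  have := h.hasStrictDerivAt (u : OnePoint ℂ)
  rw [← coe_toComplex hu, coord_coe, coord_coe] at this
  exact this

lemma HasLift.isOpen_finite (h : HasLift S) : IsOpen {u : ℂ | S u ≠ OnePoint.infty} :=
  h.isOpen_preimage ((0 : ℂ) : OnePoint ℂ) ((0 : ℂ) : OnePoint ℂ)

lemma continuousOn_toComplex {V : Set ℂ} {Γ : ℂ → RiemannSphere} (hΓ : ContinuousOn Γ V)
    (hfin : ∀ z ∈ V, Γ z ≠ OnePoint.infty) : ContinuousOn (fun z => toComplex (Γ z)) V := by
  rw [OnePoint.isOpenEmbedding_coe.isInducing.continuousOn_iff]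
  exact hΓ.congr fun z hz => coe_toComplex (hfin z hz)

/-- Near each point a continuous lift agrees with the local inverse of `S` composed with `φ`, so it
is holomorphic. -/
lemma HasLift.differentiableOn_lift (h : HasLift S) {V : Set ℂ} (hV : IsOpen V)
    {Γ : ℂ → RiemannSphere} (hΓ : ContinuousOn Γ V) (hfin : ∀ z ∈ V, Γ z ≠ OnePoint.infty)
    {φ : ℂ → ℂ} (hφ : DifferentiableOn ℂ φ V) (hS : ∀ z ∈ V, S (Γ z) = φ z)
    (hcv : ∀ z ∈ V, (φ z : RiemannSphere) ∉ criticalValues S) :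
    DifferentiableOn ℂ (fun z => toComplex (Γ z)) V := by
  intro z hz
  have hc := (continuousOn_toComplex hΓ hfin).continuousAt (hV.mem_nhds hz)
  have hw : ((toComplex (Γ z) : ℂ) : OnePoint ℂ) = Γ z := coe_toComplex (hfin z hz)
  have hF := h.hasStrictDerivAt_coe (u := toComplex (Γ z))
    (by rw [hw, hS z hz]; exact OnePoint.coe_ne_infty _)
  have hne : chartDeriv S ((toComplex (Γ z) : ℂ) : OnePoint ℂ) ≠ 0 := by
    rw [hw]
    exact fun h0 => hcv z hz ⟨Γ z, h0, hS z hz⟩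
  have hinv := (hF.hasStrictFDerivAt_equiv hne).eventually_left_inverse
  have hval : toComplex (S ((toComplex (Γ z) : ℂ) : OnePoint ℂ)) = φ z := by
    rw [hw, hS z hz, toComplex_coe]
  have hd := (hF.to_localInverse hne).hasDerivAt.differentiableAt
  rw [hval] at hd
  have := hd.comp z ((hφ z hz).differentiableAt (hV.mem_nhds hz))
  refine (this.congr_of_eventuallyEq ?_).differentiableWithinAt
  filter_upwards [hc.eventually hinv, hV.mem_nhds hz] with y hy hyV
  have hy' : toComplex (S ((toComplex (Γ y) : ℂ) : OnePoint ℂ)) = φ y := by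
    rw [coe_toComplex (hfin y hyV), hS y hyV, toComplex_coe]
  rw [hy'] at hy
  exact hy.symm

end RiemannSphere

/-! ### Maps with at most one critical value -/

namespace RiemannSphere

variable {S : RiemannSphere → RiemannSphere}

lemma mobInv_self (q : RiemannSphere) : mobInv q q = OnePoint.infty := by
  have := mobInv_mob q OnePoint.infty
  rwa [mob_infty] at this

lemma mobInv_eq_infty {q z : RiemannSphere} : mobInv q z = OnePoint.infty ↔ z = q := by
  refine ⟨fun h => ?_, fun h => h ▸ mobInv_self q⟩
  rw [← mob_mobInv q z, h, mob_infty]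

lemma chartDeriv_mob_ne_zero (q z : RiemannSphere) : chartDeriv (mob q) z ≠ 0 := by
  have := chartDeriv_mul_of_leftInverse (hasLift_mobInv q) (hasLift_mob q) (mobInv_mob q) z
  exact right_ne_zero_of_mul_eq_one this

lemma chartDeriv_mobInv_ne_zero (q z : RiemannSphere) : chartDeriv (mobInv q) z ≠ 0 := by
  have := chartDeriv_mul_of_leftInverse (hasLift_mob q) (hasLift_mobInv q) (mob_mobInv q) z
  exact right_ne_zero_of_mul_eq_one this

lemma HasLift.criticalValues_comp_mob (h : HasLift S) (q : RiemannSphere) :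
    criticalValues (S ∘ mob q) = criticalValues S := by
  ext c
  constructor
  · rintro ⟨b, hb, rfl⟩
    refine ⟨mob q b, ?_, rfl⟩
    have := h.chartDeriv_comp (hasLift_mob q) b
    rw [show chartDeriv (S ∘ mob q) b = 0 from hb] at this
    exact (mul_eq_zero.1 this.symm).resolve_right (chartDeriv_mob_ne_zero q b)
  · rintro ⟨b, hb, rfl⟩
    refine ⟨mobInv q b, ?_, by simp [mob_mobInv q b]⟩
    change chartDeriv (S ∘ mob q) _ = 0
    rw [h.chartDeriv_comp (hasLift_mob q), mob_mobInv q b,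
      show chartDeriv S b = 0 from hb, zero_mul]

lemma HasLift.criticalValues_mobInv_comp (h : HasLift S) (q : RiemannSphere) :
    criticalValues (mobInv q ∘ S) = mobInv q '' criticalValues S := by
  have : {b | chartDeriv (mobInv q ∘ S) b = 0} = {b | chartDeriv S b = 0} := by
    ext b
    change chartDeriv (mobInv q ∘ S) b = 0 ↔ chartDeriv S b = 0
    rw [(hasLift_mobInv q).chartDeriv_comp h, mul_eq_zero,
      or_iff_right (chartDeriv_mobInv_ne_zero q _)]
  rw [criticalValues, this, image_comp, criticalValues]

/-- Over ℂ the map is a covering, so it has sections `Γ` through `a` and `Λ` through ∞. If a ≠ ∞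
their ranges are disjoint; `Λ` covers a neighbourhood of ∞, so `Γ` is a bounded entire function,
hence constant, which a section cannot be. -/
lemma HasLift.eq_infty_of_criticalValues_subset (h : HasLift S)
    (hcv : criticalValues S ⊆ {OnePoint.infty}) {w : ℂ} (hw : S OnePoint.infty = w)
    {a : RiemannSphere} (ha : S a = w) : a = OnePoint.infty := by
  by_contra hne
  have hcv' : ∀ z ∈ (univ : Set ℂ), ((z : ℂ) : RiemannSphere) ∉ criticalValues S :=
    fun z _ hz => OnePoint.coe_ne_infty z (hcv hz)
  have hcont : ContinuousOn ((↑) : ℂ → RiemannSphere) univ :=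
    OnePoint.continuous_coe.continuousOn
  obtain ⟨Γ, hΓ, hΓw, hΓS⟩ := h.exists_lift isOpen_univ convex_univ hcont hcv' (mem_univ w) ha
  obtain ⟨Λ, hΛ, hΛw, hΛS⟩ := h.exists_lift isOpen_univ convex_univ hcont hcv' (mem_univ w) hw
  have hdisj : ∀ z z', Γ z ≠ Λ z' := by
    intro z z' hzz
    have hz : z = z' := by
      have := hΓS z (mem_univ _)
      rw [hzz, hΛS z' (mem_univ _)] at this
      exact (OnePoint.coe_injective this).symm
    subst hz
    have huniq := (h.existsUnique_lift isOpen_univ convex_univ hcont hcv' (mem_univ z)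
      (hΛS z (mem_univ z))).unique
      (y₁ := ⟨_, hΓ.domRestrict⟩) (y₂ := ⟨_, hΛ.domRestrict⟩)
      ⟨hzz, funext fun u => hΓS u (mem_univ _)⟩ ⟨rfl, funext fun u => hΛS u (mem_univ _)⟩
    have := congrArg (fun Θ : C((univ : Set ℂ), RiemannSphere) => Θ ⟨w, mem_univ w⟩) huniq
    exact hne ((hΓw.symm.trans this).trans hΛw)
  have hd0 : chartDeriv S OnePoint.infty ≠ 0 := fun h0 =>
    hcv' w (mem_univ _) ⟨_, h0, hw⟩
  obtain ⟨e, he, hSe⟩ := h.exists_openPartialHomeomorph hd0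
  have hrange : ∀ᶠ y in 𝓝 (OnePoint.infty : RiemannSphere), y ∈ range Λ := by
    have h1 : ∀ᶠ z in 𝓝 w, Λ z ∈ e.source :=
      (hΛ.continuousAt univ_mem).eventually (by rw [hΛw]; exact e.open_source.mem_nhds he)
    have h2 : ∀ᶠ y in 𝓝 (OnePoint.infty : RiemannSphere), ∃ z : ℂ, Λ z ∈ e.source ∧ S y = z := by
      have h3 : ∀ᶠ y : RiemannSphere in 𝓝 (w : RiemannSphere), ∃ z : ℂ, Λ z ∈ e.source ∧ y = z := by
        rw [OnePoint.nhds_coe_eq]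
        exact h1.mono fun z hz => ⟨z, hz, rfl⟩
      rw [← hw] at h3
      exact h.continuous.continuousAt.eventually h3
    filter_upwards [h2, e.open_source.mem_nhds he] with y ⟨z, hz, hyz⟩ hy
    refine ⟨z, e.injOn hz hy ?_⟩
    rw [← hSe hz, ← hSe hy, hyz, hΛS z (mem_univ _)]
  have hfin : ∀ z ∈ (univ : Set ℂ), Γ z ≠ OnePoint.infty := fun z _ hz =>
    hdisj z w (hz.trans hΛw.symm)
  have hdiff : Differentiable ℂ fun z => toComplex (Γ z) :=
    differentiableOn_univ.1 (h.differentiableOn_lift isOpen_univ hΓ hfin differentiableOn_id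
      hΓS hcv')
  have hbdd : Bornology.IsBounded (range fun z => toComplex (Γ z)) := by
    have h1 : ∀ᶠ u : ℂ in cocompact ℂ, (u : RiemannSphere) ∈ range Λ := by
      rw [← coclosedCompact_eq_cocompact]
      exact OnePoint.tendsto_coe_infty.eventually hrange
    rw [← cobounded_eq_cocompact] at h1
    refine (Bornology.isBounded_def.2 ?_ : Bornology.IsBounded
      {u : ℂ | (u : RiemannSphere) ∉ range Λ}).subset ?_
    · refine mem_of_superset h1 fun u hu hu' => hu' hu
    · rintro _ ⟨z, rfl⟩ ⟨z', hz'⟩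
      change Λ z' = ((toComplex (Γ z) : ℂ) : OnePoint ℂ) at hz'
      rw [coe_toComplex (hfin z (mem_univ _))] at hz'
      exact hdisj z z' hz'.symm
  have hconst := hdiff.apply_eq_apply_of_bounded hbdd w (w + 1)
  have h2 : Γ w = Γ (w + 1) := by
    rw [← coe_toComplex (hfin w (mem_univ _)), ← coe_toComplex (hfin (w + 1) (mem_univ _))]
    exact congrArg _ hconst
  have h3 := hΓS w (mem_univ _)
  rw [h2, hΓS _ (mem_univ _)] at h3
  simpa using OnePoint.coe_injective h3

lemma HasLift.eq_of_criticalValues_subset (h : HasLift S) {c : RiemannSphere}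
    (hcv : criticalValues S ⊆ {c}) {a b : RiemannSphere} (hab : S a = S b) (ha : S a ≠ c) :
    a = b := by
  have hL : HasLift ((mobInv c ∘ S) ∘ mob b) := ((hasLift_mobInv c).comp h).comp (hasLift_mob b)
  have hsub : criticalValues ((mobInv c ∘ S) ∘ mob b) ⊆ {OnePoint.infty} := by
    rw [((hasLift_mobInv c).comp h).criticalValues_comp_mob, h.criticalValues_mobInv_comp]
    rintro _ ⟨y, hy, rfl⟩
    rw [hcv hy, mobInv_self, mem_singleton_iff]
  have hfin : mobInv c (S b) ≠ OnePoint.infty := fun h0 =>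
    ha (hab.trans (mobInv_eq_infty.1 h0))
  have := hL.eq_infty_of_criticalValues_subset hsub (w := toComplex (mobInv c (S b)))
    (a := mobInv b a) ?_ ?_
  · exact mobInv_eq_infty.1 this
  · rw [coe_toComplex hfin, Function.comp, Function.comp, mob_infty]
  · rw [coe_toComplex hfin, Function.comp, Function.comp, mob_mobInv b a, hab]

end RiemannSphere

/-! ### Rational maps and their critical values -/

namespace Polynomial

/-- The homogenization of degree `d` of `p`. -/
def homEval (p : Polynomial ℂ) (d : ℕ) (v : ℂ × ℂ) : ℂ :=
  ∑ i ∈ Finset.range (d + 1), p.coeff i * v.1 ^ i * v.2 ^ (d - i)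

lemma differentiable_homEval (p : Polynomial ℂ) (d : ℕ) : Differentiable ℂ (p.homEval d) := by
  unfold homEval
  fun_prop

lemma homEval_smul (p : Polynomial ℂ) (d : ℕ) (c : ℂ) (v : ℂ × ℂ) :
    p.homEval d (c • v) = c ^ d * p.homEval d v := by
  rw [homEval, homEval, Finset.mul_sum]
  refine Finset.sum_congr rfl fun i hi => ?_
  rw [← Nat.add_sub_of_le (Nat.lt_succ_iff.1 (Finset.mem_range.1 hi)), pow_add c]
  simp only [Prod.smul_fst, Prod.smul_snd, smul_eq_mul, mul_pow, Nat.add_sub_cancel_left]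
  ring

lemma homEval_one {p : Polynomial ℂ} {d : ℕ} (h : p.natDegree ≤ d) (z : ℂ) :
    p.homEval d (z, 1) = p.eval z := by
  rw [eval_eq_sum_range' (Nat.lt_succ_of_le h)]
  simp [homEval]

lemma homEval_infty (p : Polynomial ℂ) (d : ℕ) : p.homEval d (1, 0) = p.coeff d := by
  rw [homEval, Finset.sum_range_succ, Finset.sum_eq_zero]
  · simp
  · intro i hi
    have : d - i ≠ 0 := by have := Finset.mem_range.1 hi; omega
    simp [this]

end Polynomial

namespace RatFunc

open RiemannSphere Polynomial

variable (R : RatFunc ℂ)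

/-- The lift of `R.sphereMap` to homogeneous coordinates. -/
def sphereLift (v : ℂ × ℂ) : ℂ × ℂ :=
  (R.num.homEval R.mapDegree v, R.denom.homEval R.mapDegree v)

lemma sphereLift_smul (c : ℂ) (v : ℂ × ℂ) :
    R.sphereLift (c • v) = c ^ R.mapDegree • R.sphereLift v := by
  simp [sphereLift, homEval_smul]

lemma sphereLift_coe (z : ℂ) : R.sphereLift (z, 1) = (R.num.eval z, R.denom.eval z) := by
  rw [sphereLift, homEval_one (show _ ≤ R.mapDegree from le_max_left _ _),
    homEval_one (show _ ≤ R.mapDegree from le_max_right _ _)]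

lemma sphereLift_infty :
    R.sphereLift (1, 0) = (R.num.coeff R.mapDegree, R.denom.coeff R.mapDegree) := by
  rw [sphereLift, homEval_infty, homEval_infty]

lemma num_or_denom_eval_ne_zero (z : ℂ) : R.num.eval z ≠ 0 ∨ R.denom.eval z ≠ 0 := by
  by_contra! h
  obtain ⟨a, b, hab⟩ := R.isCoprime_num_denom
  have := congrArg (Polynomial.eval z) hab
  simp [h.1, h.2] at this

lemma num_or_denom_coeff_ne_zero :
    R.num.coeff R.mapDegree ≠ 0 ∨ R.denom.coeff R.mapDegree ≠ 0 := by
  by_contra! h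
  rcases le_total R.num.natDegree R.denom.natDegree with hle | hle
  · rw [mapDegree, max_eq_right hle] at h
    exact R.denom_ne_zero (leadingCoeff_eq_zero.1 h.2)
  · rw [mapDegree, max_eq_left hle] at h
    have h0 : R.num = 0 := leadingCoeff_eq_zero.1 h.1
    have hd : R.denom.natDegree = 0 := by
      rw [h0, natDegree_zero] at hle
      omega
    apply R.denom_ne_zero
    rw [← leadingCoeff_eq_zero, leadingCoeff, hd]
    simpa [h0] using h.2

lemma sphereLift_ne_zero {v : ℂ × ℂ} (hv : v ≠ 0) : R.sphereLift v ≠ 0 := by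
  obtain ⟨c, hc, hvc⟩ := exists_smul_rep hv
  rw [hvc, sphereLift_smul]
  refine smul_ne_zero (pow_ne_zero _ hc) ?_
  generalize proj v = z
  induction z using OnePoint.rec with
  | infty =>
    change R.sphereLift (1, 0) ≠ 0
    rw [sphereLift_infty]
    intro h
    have h' := Prod.ext_iff.1 h
    exact R.num_or_denom_coeff_ne_zero.elim (fun k => k h'.1) (fun k => k h'.2)
  | coe z =>
    change R.sphereLift (z, 1) ≠ 0
    rw [sphereLift_coe]
    intro h
    have h' := Prod.ext_iff.1 h
    exact (R.num_or_denom_eval_ne_zero z).elim (fun k => k h'.1) (fun k => k h'.2)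

lemma sphereMap_eq (z : RiemannSphere) : R.sphereMap z = proj (R.sphereLift (rep z)) := by
  induction z using OnePoint.rec with
  | infty =>
    change _ = proj (R.sphereLift (1, 0))
    rw [sphereLift_infty]
    rfl
  | coe z =>
    change _ = proj (R.sphereLift (z, 1))
    rw [sphereLift_coe]
    rfl

lemma hasLift_sphereMap : HasLift R.sphereMap :=
  hasLift_of_homogeneous (Φ := R.sphereLift)
    ((differentiable_homEval _ _).prodMk (differentiable_homEval _ _))
    (fun _ hv => R.sphereLift_ne_zero hv) R.sphereLift_smul R.sphereMap_eq

lemma sphereMap_coe_of_ne {z : ℂ} (h : R.denom.eval z ≠ 0) :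
    R.sphereMap z = ((R.num.eval z / R.denom.eval z : ℂ) : OnePoint ℂ) := if_neg h

lemma sphereMap_coe_of_eq {z : ℂ} (h : R.denom.eval z = 0) :
    R.sphereMap z = OnePoint.infty := if_pos h

lemma coord_sphereMap_coe (b : RiemannSphere) (u : ℂ) : coord b (R.sphereMap u) =
    RiemannSphere.num b (R.num.eval u, R.denom.eval u) /
      RiemannSphere.den b (R.num.eval u, R.denom.eval u) := by
  rw [← sphereLift_coe, ← coord_proj, sphereMap_eq]
  rfl

lemma chartDeriv_sphereMap_eq_zero_iff (z : ℂ) :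
    chartDeriv R.sphereMap z = 0 ↔ (wronskian R.num R.denom).eval z = 0 := by
  have hp := R.num.hasDerivAt z
  have hq := R.denom.hasDerivAt z
  have hw : (wronskian R.num R.denom).eval z =
      R.num.eval z * R.denom.derivative.eval z - R.num.derivative.eval z * R.denom.eval z := by
    simp [wronskian]
  rw [hw]
  by_cases h : R.denom.eval z = 0
  · have hn : R.num.eval z ≠ 0 := (R.num_or_denom_eval_ne_zero z).resolve_right (by simpa using h)
    have hd : HasDerivAt (fun u : ℂ => coord (R.sphereMap z) (R.sphereMap (param z u)))
        ((R.denom.derivative.eval z * R.num.eval z - R.denom.eval z * R.num.derivative.eval z) /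
          R.num.eval z ^ 2) z := by
      refine (hq.div hp hn).congr_of_eventuallyEq (Eventually.of_forall fun u => ?_)
      rw [sphereMap_coe_of_eq R h]
      exact R.coord_sphereMap_coe OnePoint.infty u
    rw [chartDeriv, show coord (z : RiemannSphere) z = z from rfl, hd.deriv, div_eq_zero_iff,
      or_iff_left (pow_ne_zero 2 hn), mul_comm, mul_comm (R.denom.eval z)]
  · have hd : HasDerivAt (fun u : ℂ => coord (R.sphereMap z) (R.sphereMap (param z u)))
        ((R.num.derivative.eval z * R.denom.eval z - R.num.eval z * R.denom.derivative.eval z) /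
          R.denom.eval z ^ 2) z := by
      refine (hp.div hq h).congr_of_eventuallyEq (Eventually.of_forall fun u => ?_)
      rw [sphereMap_coe_of_ne R h]
      exact R.coord_sphereMap_coe (_ : ℂ) u
    rw [chartDeriv, show coord (z : RiemannSphere) z = z from rfl, hd.deriv, div_eq_zero_iff,
      or_iff_left (pow_ne_zero 2 h), ← neg_eq_zero, neg_sub]

variable {R}

lemma wronskian_ne_zero (hdeg : 2 ≤ R.mapDegree) : wronskian R.num R.denom ≠ 0 := by
  intro h
  obtain ⟨h1, h2⟩ := R.isCoprime_num_denom.wronskian_eq_zero_iff.1 h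
  rw [mapDegree, derivative_eq_zero.1 h1,
    derivative_eq_zero.1 h2] at hdeg
  simp at hdeg

lemma finite_criticalValues (hdeg : 2 ≤ R.mapDegree) : (criticalValues R.sphereMap).Finite := by
  refine Set.Finite.image _ ?_
  refine (((wronskian R.num R.denom).finite_setOfPred_isRoot (wronskian_ne_zero hdeg)).image
    ((↑) : ℂ → OnePoint ℂ) |>.insert OnePoint.infty).subset fun z hz => ?_
  induction z using OnePoint.rec with
  | infty => exact mem_insert _ _
  | coe z => exact Or.inr ⟨z, (R.chartDeriv_sphereMap_eq_zero_iff z).1 hz, rfl⟩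

/-- With c as the only possible critical value the map is injective over the complement of c, but a
generic value has at least two preimages. -/
lemma exists_criticalValue_ne (hdeg : 2 ≤ R.mapDegree) (c : RiemannSphere) :
    (criticalValues R.sphereMap \ {c}).Nonempty := by
  by_contra! hempty
  have hsub : criticalValues R.sphereMap ⊆ {c} := sdiff_eq_empty.1 hempty
  obtain ⟨w, hw⟩ : ∃ w : ℂ, (w : RiemannSphere) ∉ ({c, R.sphereMap OnePoint.infty} : Set _) := by
    by_contra! h
    refine (infinite_univ (α := ℂ)) (((toFinite ({c, R.sphereMap OnePoint.infty} :
      Set RiemannSphere)).preimage (OnePoint.coe_injective.injOn)).subset fun w _ => h w)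
  simp only [mem_insert_iff, mem_singleton_iff, not_or] at hw
  set P := R.num - Polynomial.C w * R.denom with hP
  have hroot : ∀ u, P.eval u = 0 → R.denom.eval u ≠ 0 ∧ R.sphereMap u = w := by
    intro u hu
    have hu' : R.num.eval u = w * R.denom.eval u := by simpa [hP, sub_eq_zero] using hu
    have hq : R.denom.eval u ≠ 0 := fun h =>
      (R.num_or_denom_eval_ne_zero u).elim (fun k => k (by rw [hu', h, mul_zero])) (fun k => k h)
    refine ⟨hq, ?_⟩
    rw [R.sphereMap_coe_of_ne hq, hu', mul_div_cancel_right₀ _ hq]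
  -- A double root would be a critical point with value `w ≠ c`.
  have hsep : P.Separable := by
    rw [Polynomial.Separable, isCoprime_iff_aeval_ne_zero_of_isAlgClosed ℂ ℂ]
    intro u
    by_contra! h
    simp only [coe_aeval_eq_eval] at h
    obtain ⟨-, hu⟩ := hroot u h.1
    have h1 : R.num.eval u = w * R.denom.eval u := by simpa [hP, sub_eq_zero] using h.1
    have h2 : R.num.derivative.eval u = w * R.denom.derivative.eval u := by
      simpa [hP, sub_eq_zero] using h.2
    refine hw.1 (hsub ⟨u, ?_, hu⟩)
    refine (R.chartDeriv_sphereMap_eq_zero_iff u).2 ?_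
    simp only [wronskian, eval_sub, Polynomial.eval_mul, h1, h2]
    ring
  -- `w` differs from the value at ∞, so no root escapes to ∞ and `P` has full degree.
  have hcoeff : P.coeff R.mapDegree ≠ 0 := by
    intro h
    have h1 : R.num.coeff R.mapDegree = w * R.denom.coeff R.mapDegree := by
      simpa [hP, sub_eq_zero] using h
    have hq : R.denom.coeff R.mapDegree ≠ 0 := fun h =>
      R.num_or_denom_coeff_ne_zero.elim (fun k => k (by rw [h1, h, mul_zero])) (fun k => k h)
    refine hw.2 ?_
    rw [show R.sphereMap OnePoint.infty = _ from if_neg hq, h1, mul_div_cancel_right₀ _ hq]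
  have hcard : 2 ≤ P.roots.toFinset.card := by
    rw [Multiset.toFinset_card_of_nodup (nodup_roots hsep),
      ← (IsAlgClosed.splits P).natDegree_eq_card_roots]
    exact hdeg.trans (le_natDegree_of_ne_zero hcoeff)
  obtain ⟨u, hu, v, hv, huv⟩ := Finset.one_lt_card.1 hcard
  simp only [Multiset.mem_toFinset, mem_roots', IsRoot.def] at hu hv
  refine huv (OnePoint.coe_injective ?_)
  refine R.hasLift_sphereMap.eq_of_criticalValues_subset hsub ?_ ?_
  · exact (hroot u hu.2).2.trans (hroot v hv.2).2.symm
  · rw [(hroot u hu.2).2]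
    exact hw.1

end RatFunc

namespace RiemannSphere

variable {S : RiemannSphere → RiemannSphere}

/-! ### Attracting cycles -/

lemma HasLift.chartDeriv_iterate_fixed (h : HasLift S) {p : RiemannSphere} (hp : S p = p) (k : ℕ) :
    chartDeriv S^[k] p = chartDeriv S p ^ k := by
  induction k with
  | zero => exact chartDeriv_id p
  | succ k ih => rw [Function.iterate_succ, (h.iterate k).chartDeriv_comp h, hp, ih, pow_succ]

/-- The multiplier over m is a power of the one over the minimal period, and continuity of the first
m iterates extends convergence from one residue class to the whole orbit. -/
lemma HasLift.inAttractingBasin (h : HasLift S) {z p : RiemannSphere} {t m : ℕ} (hm : 0 < m)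
    (hp : S^[m] p = p) (hder : ‖chartDeriv S^[m] p‖ < 1)
    (hlim : Tendsto (fun j : ℕ => S^[t + m * j] z) atTop (𝓝 p)) : InAttractingBasin S z := by
  have hper : Function.IsPeriodicPt S m p := hp
  refine ⟨p, ⟨Function.mk_mem_periodicPts hm hper, ?_⟩, ?_⟩
  · obtain ⟨k, hk⟩ := hper.minimalPeriod_dvd
    rw [hk, Function.iterate_mul, (h.iterate _).chartDeriv_iterate_fixed
      Function.iterate_minimalPeriod, norm_pow] at hder
    by_contra! hge
    exact absurd hder (not_lt.2 (one_le_pow₀ hge))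
  · rw [(hasBasis_nhdsSet _).tendsto_right_iff]
    rintro O ⟨hO, hsub⟩
    have hall : ∀ᶠ j in atTop, ∀ i < m, S^[i] (S^[t + m * j] z) ∈ O := by
      have : ∀ i ∈ Iio m, ∀ᶠ j in atTop, S^[i] (S^[t + m * j] z) ∈ O := fun i _ =>
        (((h.iterate i).continuous.tendsto p).comp hlim).eventually
          (hO.mem_nhds (hsub ⟨i, rfl⟩))
      exact (eventually_all_finite (finite_Iio m)).2 this
    obtain ⟨J, hJ⟩ := eventually_atTop.1 hall
    filter_upwards [eventually_ge_atTop (t + m * J)] with n hn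
    have hj : J ≤ (n - t) / m := (Nat.le_div_iff_mul_le hm).2 (by rw [mul_comm]; omega)
    have := hJ _ hj _ (Nat.mod_lt (n - t) hm)
    rw [← Function.iterate_add_apply] at this
    have e : (n - t) % m + (t + m * ((n - t) / m)) = n := by
      have := Nat.mod_add_div (n - t) m
      omega
    rwa [e] at this

/-! ### The affine model -/

/-- The expression of `S` in the affine coordinate. -/
def affine (S : RiemannSphere → RiemannSphere) (u : ℂ) : ℂ := toComplex (S u)

/-- The points of `ℂ` with finite image. -/
def finiteDomain (S : RiemannSphere → RiemannSphere) : Set ℂ := {u | S u ≠ OnePoint.infty}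

lemma coe_affine_iterate {k : ℕ} {u : ℂ} (hu : ∀ i < k, (affine S)^[i] u ∈ finiteDomain S) :
    (((affine S)^[k] u : ℂ) : OnePoint ℂ) = S^[k] u := by
  induction k with
  | zero => rfl
  | succ k ih =>
    have hk := hu k k.lt_succ_self
    rw [Function.iterate_succ_apply', Function.iterate_succ_apply',
      ← ih fun i hi => hu i (hi.trans k.lt_succ_self)]
    exact coe_toComplex hk

lemma HasLift.differentiableOn_affine (h : HasLift S) :
    DifferentiableOn ℂ (affine S) (finiteDomain S) := fun _ hu =>
  (h.hasStrictDerivAt_coe hu).hasDerivAt.differentiableAt.differentiableWithinAt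

lemma HasLift.chartDeriv_iterate_coe (h : HasLift S) {k : ℕ} {u : ℂ}
    (hu : ∀ i < k, (affine S)^[i] u ∈ finiteDomain S) :
    chartDeriv S^[k] u = deriv (affine S)^[k] u := by
  induction k with
  | zero => rw [Function.iterate_zero, Function.iterate_zero, chartDeriv_id, deriv_id]
  | succ k ih =>
    have hu' : ∀ i < k, (affine S)^[i] u ∈ finiteDomain S :=
      fun i hi => hu i (hi.trans k.lt_succ_self)
    have hk := hu k k.lt_succ_self
    rw [Function.iterate_succ', Function.iterate_succ', h.chartDeriv_comp (h.iterate k), ih hu',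
      ← coe_affine_iterate hu', chartDeriv_coe hk]
    refine (deriv_comp u ?_ ?_).symm
    · exact (h.hasStrictDerivAt_coe hk).hasDerivAt.differentiableAt
    · exact differentiableAt_iterate h.isOpen_finite h.differentiableOn_affine k hu'

lemma mem_postcriticalSet (n : ℕ) (c : RiemannSphere) : S^[n] c ∈ postcriticalSet S c :=
  subset_closure ⟨n, rfl⟩

lemma isCompact_preimage_coe {K : Set RiemannSphere} (hK : IsClosed K)
    (hinf : OnePoint.infty ∉ K) : IsCompact ((↑) ⁻¹' K : Set ℂ) := by
  refine (OnePoint.isOpenEmbedding_coe.isInducing.isCompact_preimage_iff ?_).2 hK.isCompact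
  intro z hz
  have hz' : z ≠ OnePoint.infty := fun h => hinf (h ▸ hz)
  exact ⟨toComplex z, coe_toComplex hz'⟩

/-- A point with postcritical set away from the other ones gives a planar orbit, as soon as `∞`
is one of the other critical values. -/
lemma HasLift.exists_planarOrbit (h : HasLift S) {c : RiemannSphere}
    (hfin : (criticalValues S).Finite) (hinf : OnePoint.infty ∈ criticalValues S \ {c})
    (hdisj : Disjoint (postcriticalSet S c)
      (⋃ c' ∈ criticalValues S \ {c}, postcriticalSet S c')) :
    ∃ ρ₀, PlanarOrbit (affine S) (finiteDomain S) (fun n => toComplex (S^[n] c)) ρ₀ := by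
  set X := ⋃ c' ∈ criticalValues S \ {c}, postcriticalSet S c' with hX
  have hXc : IsClosed X := (hfin.sdiff).isClosed_biUnion fun _ _ => isClosed_closure
  have hXm : ∀ c' ∈ criticalValues S, c' ≠ c → ∀ k, S^[k] c' ∈ X := fun c' hc' hne k =>
    mem_biUnion (show c' ∈ criticalValues S \ {c} from ⟨hc', hne⟩) (mem_postcriticalSet k c')
  have hP : OnePoint.infty ∉ postcriticalSet S c := fun hmem =>
    disjoint_left.1 hdisj hmem (hXm _ hinf.1 hinf.2 0)
  have hx : ∀ n, ((toComplex (S^[n] c) : ℂ) : OnePoint ℂ) = S^[n] c := fun n =>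
    coe_toComplex fun h0 => hP (h0 ▸ mem_postcriticalSet n c)
  have hK := isCompact_preimage_coe (isClosed_closure : IsClosed (postcriticalSet S c)) hP
  have hC : IsClosed ((↑) ⁻¹' X : Set ℂ) := hXc.preimage OnePoint.continuous_coe
  obtain ⟨ρ₀, hρ₀, hthick⟩ := (hdisj.preimage ((↑) : ℂ → OnePoint ℂ)).exists_thickenings hK hC
  have hxK : ∀ n, toComplex (S^[n] c) ∈ ((↑) ⁻¹' postcriticalSet S c : Set ℂ) := fun n => by
    rw [mem_preimage, hx]
    exact mem_postcriticalSet n c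
  have hnear : ∀ n, ∀ z ∈ ball (toComplex (S^[n] c)) ρ₀, (z : RiemannSphere) ∉ X := fun n z hz hzX =>
    disjoint_left.1 hthick (mem_thickening_iff.2 ⟨_, hxK n, hz⟩)
      (self_subset_thickening hρ₀ _ hzX)
  refine ⟨ρ₀, h.isOpen_finite, h.differentiableOn_affine, fun n => ?_, fun n => ?_,
    hK.isBounded.subset (range_subset_iff.2 hxK), hρ₀, ?_⟩
  · change S _ ≠ _
    rw [hx, ← Function.iterate_succ_apply' S, ← hx]
    exact OnePoint.coe_ne_infty _
  · change toComplex (S _) = _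
    rw [hx, ← Function.iterate_succ_apply' S]
  · intro n k ρ φ hρ hρρ hkn hφ h0
    have hiter : ∀ z ∈ ball (toComplex (S^[n] c)) ρ, S^[k] (φ z) = z := fun z hz => by
      rw [← coe_affine_iterate (hφ.mem z hz), hφ.inv z hz]
    -- A critical value other than `c` in the image would put `z` in `X`; the value `c` itself is
    -- excluded by `h0`.
    have hcv : ∀ z ∈ ball (toComplex (S^[n] c)) ρ, (φ z : RiemannSphere) ∉ criticalValues S := by
      intro z hz hz'
      by_cases hzc : (φ z : RiemannSphere) = c
      · refine h0 ⟨z, hz, ?_⟩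
        change φ z = toComplex c
        rw [← hzc]
        rfl
      · refine hnear n z (ball_subset_ball hρρ hz) ?_
        rw [← hiter z hz]
        exact hXm _ hz' hzc k
    have hbase : S (S^[n - (k + 1)] c) = φ (toComplex (S^[n] c)) := by
      rw [hφ.base, hx, ← Function.iterate_succ_apply' S, Nat.succ_eq_add_one,
        show n - (k + 1) + 1 = n - k by omega]
    obtain ⟨Γ, hΓ, hΓb, hΓS⟩ := h.exists_lift isOpen_ball (convex_ball _ _)
      (OnePoint.continuous_coe.comp_continuousOn hφ.holo.continuousOn) hcv
      (mem_ball_self hρ) hbase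
    -- ∞ is one of the other critical values, so its forward orbit lies in `X` and the lift cannot
    -- reach it.
    have hΓfin : ∀ z ∈ ball (toComplex (S^[n] c)) ρ, Γ z ≠ OnePoint.infty := by
      intro z hz h1
      refine hnear n z (ball_subset_ball hρρ hz) ?_
      have h2 : S (Γ z) = φ z := hΓS z hz
      rw [← hiter z hz, ← h2, h1, ← Function.iterate_succ_apply]
      exact hXm _ hinf.1 hinf.2 _
    have hstep : ∀ z ∈ ball (toComplex (S^[n] c)) ρ, affine S (toComplex (Γ z)) = φ z := by
      intro z hz
      rw [affine, coe_toComplex (hΓfin z hz), hΓS z hz]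
      rfl
    refine ⟨fun z => toComplex (Γ z), h.differentiableOn_lift isOpen_ball hΓ hΓfin hφ.holo hΓS hcv,
      ?_, fun z hz i hi => ?_, fun z hz => ?_⟩
    · rw [hΓb]
    · cases i with
      | zero =>
        change S ((toComplex (Γ z) : ℂ) : OnePoint ℂ) ≠ _
        rw [coe_toComplex (hΓfin z hz), hΓS z hz]
        exact OnePoint.coe_ne_infty _
      | succ i =>
        rw [Function.iterate_succ_apply, hstep z hz]
        exact hφ.mem z hz i (by omega)
    · rw [Function.iterate_succ_apply, hstep z hz, hφ.inv z hz]

end RiemannSphere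

namespace RiemannSphere

variable {g S : RiemannSphere → RiemannSphere}

/-! ### The spherical derivative of the Möbius maps -/

lemma mob_none (z : RiemannSphere) : mob OnePoint.infty z = z := proj_rep z

lemma coord_mob_coe (q u : ℂ) (b : RiemannSphere) :
    coord b (mob (q : OnePoint ℂ) (u : OnePoint ℂ)) = num b (q * u + 1, u) / den b (q * u + 1, u) :=
  coord_proj b _

lemma chartDeriv_mob_coe (q : ℂ) {u : ℂ} (hu : u ≠ 0) :
    chartDeriv (mob (q : OnePoint ℂ)) (u : OnePoint ℂ) = -1 / u ^ 2 := by
  have hb : mob (q : OnePoint ℂ) (u : OnePoint ℂ) = ((q * u + 1) / u : ℂ) := if_neg hu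
  have hd : HasDerivAt (fun w : ℂ => coord (mob (q : OnePoint ℂ) (u : OnePoint ℂ))
      (mob (q : OnePoint ℂ) (param (u : OnePoint ℂ) w))) ((q * 1 * u - (q * u + 1) * 1) / u ^ 2) u := by
    rw [hb]
    refine (((((hasDerivAt_id u).const_mul q).add_const 1).div (hasDerivAt_id u) hu)).congr_of_eventuallyEq
      (Eventually.of_forall fun w => ?_)
    exact coord_mob_coe q w _
  rw [chartDeriv, show coord (u : RiemannSphere) u = u from rfl, hd.deriv]
  ring

lemma chartDeriv_mob_zero (q : ℂ) :
    chartDeriv (mob (q : OnePoint ℂ)) ((0 : ℂ) : OnePoint ℂ) = 1 := by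
  have hb : mob (q : OnePoint ℂ) ((0 : ℂ) : OnePoint ℂ) = OnePoint.infty := if_pos rfl
  have hd : HasDerivAt (fun w : ℂ => coord (mob (q : OnePoint ℂ) ((0 : ℂ) : OnePoint ℂ))
      (mob (q : OnePoint ℂ) (param ((0 : ℂ) : OnePoint ℂ) w)))
      ((1 * (q * 0 + 1) - 0 * (q * 1)) / (q * 0 + 1) ^ 2) 0 := by
    rw [hb]
    refine ((hasDerivAt_id (0 : ℂ)).div (((hasDerivAt_id (0 : ℂ)).const_mul q).add_const 1)
      (by simp)).congr_of_eventuallyEq (Eventually.of_forall fun w => ?_)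
    exact coord_mob_coe q w OnePoint.infty
  rw [chartDeriv, show coord ((0 : ℂ) : RiemannSphere) ((0 : ℂ) : OnePoint ℂ) = 0 from rfl,
    hd.deriv]
  simp

lemma density_coe (u : ℂ) : density (u : OnePoint ℂ) = 2 / (1 + ‖u‖ ^ 2) := rfl

lemma density_infty : density (OnePoint.infty : RiemannSphere) = 2 := by
  change 2 / (1 + ‖(0 : ℂ)‖ ^ 2) = (2 : ℝ)
  simp

/-- Bounds from below the passage from the planar metric to the spherical one through the Möbius map
on a bounded set; the constant serves all points of the orbit at once. -/
lemma exists_le_density_mul_mob (q : RiemannSphere) {M : ℝ} (hM : 0 ≤ M) :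
    ∃ C > 0, ∀ u : ℂ, ‖u‖ ≤ M → C ≤ density (mob q u) * ‖chartDeriv (mob q) u‖ := by
  induction q using OnePoint.rec with
  | infty =>
    refine ⟨2 / (1 + M ^ 2), by positivity, fun u hu => ?_⟩
    have : mob OnePoint.infty = id := funext mob_none
    rw [this, chartDeriv_id, id, density_coe, norm_one, mul_one]
    gcongr
  | coe q =>
    refine ⟨2 / (M ^ 2 + (‖q‖ * M + 1) ^ 2), by positivity, fun u hu => ?_⟩
    by_cases h0 : u = 0
    · subst h0
      have hb : mob (q : OnePoint ℂ) ((0 : ℂ) : OnePoint ℂ) = OnePoint.infty := if_pos rfl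
      rw [hb, density_infty, chartDeriv_mob_zero, norm_one, mul_one]
      refine div_le_self zero_le_two ?_
      have : 0 ≤ ‖q‖ * M := by positivity
      nlinarith [sq_nonneg M]
    · have hb : mob (q : OnePoint ℂ) (u : OnePoint ℂ) = ((q * u + 1) / u : ℂ) := if_neg h0
      have hu0 : 0 < ‖u‖ := norm_pos_iff.2 h0
      rw [hb, density_coe, chartDeriv_mob_coe q h0, norm_div, norm_div, norm_neg, norm_one,
        norm_pow, ← mul_div_assoc, mul_one, div_div]
      have e : (1 + (‖q * u + 1‖ / ‖u‖) ^ 2) * ‖u‖ ^ 2 = ‖u‖ ^ 2 + ‖q * u + 1‖ ^ 2 := by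
        field_simp
      rw [e]
      have h1 : ‖q * u + 1‖ ≤ ‖q‖ * M + 1 := by
        refine (norm_add_le _ _).trans ?_
        rw [norm_mul, norm_one]
        gcongr
      gcongr

/-! ### Conjugation by a Möbius map -/

/-- The conjugate of `g` by `mob q`. -/
def conj (g : RiemannSphere → RiemannSphere) (q : RiemannSphere) : RiemannSphere → RiemannSphere :=
  (mobInv q ∘ g) ∘ mob q

lemma HasLift.conj (h : HasLift g) (q : RiemannSphere) : HasLift (conj g q) :=
  ((hasLift_mobInv q).comp h).comp (hasLift_mob q)

lemma mob_conj_iterate (g : RiemannSphere → RiemannSphere) (q z : RiemannSphere) (n : ℕ) :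
    mob q ((conj g q)^[n] z) = g^[n] (mob q z) :=
  Function.Semiconj.iterate_right (f := mob q) (fun z => mob_mobInv q (g (mob q z))) n z

lemma conj_iterate_mobInv (g : RiemannSphere → RiemannSphere) (q z : RiemannSphere) (n : ℕ) :
    (conj g q)^[n] (mobInv q z) = mobInv q (g^[n] z) := by
  rw [← mobInv_mob q ((conj g q)^[n] (mobInv q z)), mob_conj_iterate, mob_mobInv q z]

lemma HasLift.criticalValues_conj (h : HasLift g) (q : RiemannSphere) :
    criticalValues (RiemannSphere.conj g q) = mobInv q '' criticalValues g := by
  rw [RiemannSphere.conj, ((hasLift_mobInv q).comp h).criticalValues_comp_mob,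
    h.criticalValues_mobInv_comp]

lemma postcriticalSet_conj (g : RiemannSphere → RiemannSphere) (q c : RiemannSphere) :
    postcriticalSet (conj g q) (mobInv q c) = mobInv q '' postcriticalSet g c := by
  have : orbit (conj g q) (mobInv q c) = mobInv q '' orbit g c := by
    rw [orbit, orbit, ← range_comp]
    exact congrArg range (funext fun n => conj_iterate_mobInv g q c n)
  rw [postcriticalSet, this]
  exact ((mobHomeomorph q).symm.image_closure _).symm

lemma HasLift.disjoint_postcriticalSet_conj (h : HasLift g) (q : RiemannSphere) {c : RiemannSphere}
    (hdisj : Disjoint (postcriticalSet g c)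
      (⋃ c' ∈ criticalValues g \ {c}, postcriticalSet g c')) :
    Disjoint (postcriticalSet (RiemannSphere.conj g q) (mobInv q c))
      (⋃ c' ∈ criticalValues (RiemannSphere.conj g q) \ {mobInv q c},
        postcriticalSet (RiemannSphere.conj g q) c') := by
  rw [disjoint_left]
  intro y hy hy'
  obtain ⟨_, ⟨hc1, hc2⟩, hyc⟩ := mem_iUnion₂.1 hy'
  rw [h.criticalValues_conj] at hc1
  obtain ⟨c', hc', rfl⟩ := hc1
  rw [postcriticalSet_conj] at hy hyc
  obtain ⟨a, ha, rfl⟩ := hy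
  obtain ⟨b, hb, hab⟩ := hyc
  rw [(mob_mobInv q).injective hab] at hb
  have hne : c' ≠ c := fun h => hc2 (by rw [h]; rfl)
  exact disjoint_left.1 hdisj ha (mem_biUnion (show c' ∈ criticalValues g \ {c} from ⟨hc', hne⟩) hb)

lemma HasLift.chartDeriv_iterate_mob (h : HasLift g) {q p : RiemannSphere} {m : ℕ}
    (hp : (RiemannSphere.conj g q)^[m] p = p) :
    chartDeriv g^[m] (mob q p) = chartDeriv (RiemannSphere.conj g q)^[m] p := by
  have e : g^[m] ∘ mob q = mob q ∘ (RiemannSphere.conj g q)^[m] :=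
    funext fun z => (mob_conj_iterate g q z m).symm
  have h1 := (h.iterate m).chartDeriv_comp (hasLift_mob q) p
  rw [e, (hasLift_mob q).chartDeriv_comp ((h.conj q).iterate m), hp, mul_comm] at h1
  exact (mul_right_cancel₀ (chartDeriv_mob_ne_zero q p) h1).symm

/-! ### The Lyapunov exponent -/

lemma HasLift.exists_le_sphericalDeriv (h : HasLift g) {c q : RiemannSphere}
    (hfin : (criticalValues g).Finite) (hq : q ∈ criticalValues g \ {c})
    (hdisj : Disjoint (postcriticalSet g c)
      (⋃ c' ∈ criticalValues g \ {c}, postcriticalSet g c'))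
    (hbasin : ¬ InAttractingBasin g c) :
    ∃ C > 0, ∀ χ > 0, ∀ᶠ n : ℕ in atTop, C * Real.exp (-χ * n) ≤ sphericalDeriv g^[n] c := by
  set S := RiemannSphere.conj g q with hS
  have hSl : HasLift S := h.conj q
  have hinf : OnePoint.infty ∈ criticalValues S \ {mobInv q c} := by
    rw [hS, h.criticalValues_conj]
    exact ⟨⟨q, hq.1, mobInv_self q⟩, fun h0 => hq.2 (mobInv_eq_infty.1 h0.symm).symm⟩
  obtain ⟨ρ₀, ho⟩ := hSl.exists_planarOrbit
    (by rw [hS, h.criticalValues_conj]; exact hfin.image _) hinf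
    (h.disjoint_postcriticalSet_conj q hdisj)
  have hx : ∀ n, ((toComplex (S^[n] (mobInv q c)) : ℂ) : OnePoint ℂ) = S^[n] (mobInv q c) := by
    refine fun n => coe_toComplex fun h0 => ?_
    refine disjoint_left.1 (h.disjoint_postcriticalSet_conj q hdisj) (mem_postcriticalSet n _) ?_
    rw [← hS, h0]
    exact mem_biUnion hinf (mem_postcriticalSet 0 _)
  have hmem : ∀ n i, (affine S)^[i] (toComplex (S^[n] (mobInv q c))) ∈ finiteDomain S := by
    intro n i
    have := ho.iterate i n
    rw [this]
    exact ho.mem _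
  rcases ho.dichotomy with ⟨p, t, m, hm, hp, hU, hder, hlim⟩ | hexp
  · exfalso
    have hp' : S^[m] (p : OnePoint ℂ) = p := by rw [← coe_affine_iterate hU, hp]
    refine hbasin (h.inAttractingBasin (p := mob q p) (t := t) hm ?_ ?_ ?_)
    · rw [← mob_conj_iterate, ← hS, hp']
    · rwa [h.chartDeriv_iterate_mob hp', ← hS, hSl.chartDeriv_iterate_coe hU]
    · have h1 := ((hasLift_mob q).continuous.comp OnePoint.continuous_coe).tendsto p |>.comp hlim
      refine h1.congr fun j => ?_
      change mob q ((toComplex (S^[t + m * j] (mobInv q c)) : ℂ) : OnePoint ℂ) = _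
      rw [hx, hS, mob_conj_iterate, mob_mobInv q c]
  · obtain ⟨M, hM⟩ := isBounded_iff_forall_norm_le.1 ho.bounded
    have hM' : ∀ n, ‖toComplex (S^[n] (mobInv q c))‖ ≤ M := fun n => hM _ ⟨n, rfl⟩
    obtain ⟨C, hC, hCle⟩ := exists_le_density_mul_mob q ((norm_nonneg _).trans (hM' 0))
    have hD0 : 0 < density c * ‖chartDeriv (mob q) (mobInv q c)‖ :=
      mul_pos (density_pos _) (norm_pos_iff.2 (chartDeriv_mob_ne_zero _ _))
    refine ⟨C / (density c * ‖chartDeriv (mob q) (mobInv q c)‖), by positivity, fun χ hχ => ?_⟩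
    filter_upwards [hexp χ hχ] with n hn
    have e : g^[n] ∘ mob q = mob q ∘ S^[n] := funext fun z => (mob_conj_iterate g q z n).symm
    have h1 := (h.iterate n).chartDeriv_comp (hasLift_mob q) (mobInv q c)
    rw [e, (hasLift_mob q).chartDeriv_comp (hSl.iterate n), mob_mobInv q c] at h1
    have h2 : chartDeriv S^[n] (mobInv q c) =
        deriv (affine S)^[n] (toComplex (S^[0] (mobInv q c))) := by
      rw [← hSl.chartDeriv_iterate_coe fun i _ => hmem 0 i, hx]
      rfl
    have h3 := congrArg norm h1
    rw [norm_mul, norm_mul, h2] at h3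
    have h4 := hCle _ (hM' n)
    rw [hx, hS, mob_conj_iterate, ← hS, mob_mobInv q c] at h4
    have h5 := density_pos (g^[n] c)
    rw [sphericalDeriv, div_mul_eq_mul_div, div_le_div_iff₀ hD0 (density_pos c)]
    have hE := Real.exp_pos (-χ * n)
    have h6 : C * Real.exp (-χ * n) ≤ density (g^[n] c) * ‖chartDeriv g^[n] c‖ *
        ‖chartDeriv (mob q) (mobInv q c)‖ := by
      rw [mul_assoc, ← h3, ← mul_assoc]
      gcongr
    calc _ ≤ _ := mul_le_mul_of_nonneg_right h6 (density_pos c).le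
      _ = _ := by ring

/-- For y < 0 the bound with χ = -y/2 leaves room -yn/2 to absorb the constant log C. -/
lemma lowerLyapunov_nonneg {c : RiemannSphere} {C : ℝ} (hC : 0 < C)
    (h : ∀ χ > 0, ∀ᶠ n : ℕ in atTop, C * Real.exp (-χ * n) ≤ sphericalDeriv g^[n] c) :
    0 ≤ lowerLyapunov g c := by
  refine le_of_forall_lt_imp_le_of_dense fun y hy => ?_
  induction y with
  | bot => exact bot_le
  | top => exact absurd hy (by simp)
  | coe y =>
    have hy' : 0 < -y := by
      have : y < 0 := by exact_mod_cast hy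
      linarith
    refine le_liminf_of_le (by isBoundedDefault) ?_
    have hlin : ∀ᶠ n : ℕ in atTop, -Real.log C ≤ -y / 2 * n :=
      (tendsto_natCast_atTop_atTop.const_mul_atTop (half_pos hy')).eventually_ge_atTop _
    filter_upwards [h (-y / 2) (half_pos hy'), hlin, eventually_gt_atTop 0] with n hn hl hn0
    have hn0' : (0 : ℝ) < n := Nat.cast_pos.2 hn0
    have hpos : 0 < sphericalDeriv g^[n] c := (mul_pos hC (Real.exp_pos _)).trans_le hn
    have hlog : y * n ≤ Real.log (sphericalDeriv g^[n] c) := by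
      have := Real.log_le_log (mul_pos hC (Real.exp_pos _)) hn
      rw [Real.log_mul hC.ne' (Real.exp_pos _).ne', Real.log_exp] at this
      linarith
    rw [ENNReal.log_ofReal_of_pos hpos]
    have : y ≤ Real.log (sphericalDeriv g^[n] c) / n := (le_div_iff₀ hn0').2 hlog
    rw [← EReal.coe_natCast, ← EReal.coe_div]
    exact EReal.coe_le_coe_iff.2 this

end RiemannSphere

end

theorem mainTheorem7 (R : RatFunc ℂ) (hdeg : 2 ≤ R.mapDegree) (c₀ : RiemannSphere)
    (hc₀ : c₀ ∈ RiemannSphere.criticalValues R.sphereMap)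
    (hbasin : ¬ RiemannSphere.InAttractingBasin R.sphereMap c₀)
    (hdisj : Disjoint (RiemannSphere.postcriticalSet R.sphereMap c₀)
      (⋃ c ∈ RiemannSphere.criticalValues R.sphereMap \ {c₀},
        RiemannSphere.postcriticalSet R.sphereMap c)) :
    0 ≤ RiemannSphere.lowerLyapunov R.sphereMap c₀ := by
  obtain ⟨q, hq⟩ := RatFunc.exists_criticalValue_ne hdeg c₀
  obtain ⟨C, hC, h⟩ := R.hasLift_sphereMap.exists_le_sphericalDeriv
    (RatFunc.finite_criticalValues hdeg) hq hdisj hbasin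
  exact RiemannSphere.lowerLyapunov_nonneg hC h
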